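/- Let $m>0$ and $b\in(\mathbb R\setminus\{0\})\cup\{\infty\}$; put $B(p):=bp^2$ if $b\in\mathbb R\setminus\{0\}$ and $B(p):=\infty$ if $b=\infty$, with $\tfrac1\infty:=0$. Let $\theta$ be the Heaviside function. In $L^2(\mathbb R^2)$, with points $(q,p)$, let $L_0:=-i\,\tfrac pm\,\partial_q$ on its maximal domain $\{f\in L^2(\mathbb R^2): p\,\partial_q f\in L^2(\mathbb R^2)\}$ (distributional derivative), and for $f\in\operatorname{dom}(L_0)$ let $(\gamma f)(p):=f(0,p)$ be the trace on the line $q=0$. For $z\in\mathbb C\setminus\mathbb R$ set $$g_z(q,p):=\theta(qp\operatorname{Im}z)\,\operatorname{sgn}(\operatorname{Im}z)\,\frac{im}{|p|}\,e^{imzq/p},\qquad (G_z\phi)(q,p):=g_z(q,p)\,\phi(p),$$ $$(\Lambda^B_z\phi)(p):=\frac{\phi(p)}{\frac1{B(p)}-\operatorname{sgn}(\operatorname{Im}z)\frac{im}{2|p|}},\qquad (\Pi'\phi)(p):=\tfrac12\big(\phi(p)-\phi(-p)\big),$$ and let $L_B$ be the operator in $L^2(\mathbb R^2)$ with $$\operatorname{dom}(L_B)=\big\{f\in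 L^2(\mathbb R^2): f=f_z+G_z\Lambda^B_z\Pi'\gamma f_z,\ f_z\in\operatorname{dom}(L_0)\big\},\qquad (L_B-z)f=(L_0-z)f_z .$$ Then, whichever $z\in\mathbb C\setminus\mathbb R$ is used, $L_0$ and $L_B$ generate strongly continuous one-parameter unitary groups $e^{-itL_0}$ and $e^{-itL_B}$ on $L^2(\mathbb R^2)$ (with generators $-iL_0$ and $-iL_B$), and for all $f\in L^2(\mathbb R^2)$, all $t\in\mathbb R$ and almost every $(q,p)\in\mathbb R^2$, $$\big(e^{-itL_0}f\big)(q,p)=f\Big(q-\frac{pt}m,p\Big),$$ $$\big(e^{-itL_B}f\big)(q,p)=\big(e^{-itL_0}f\big)(q,p)-\frac{\theta(tqp)\,\theta\big(\frac{|pt|}m-|q|\big)}{1+\operatorname{sgn}(t)\,\frac{2i|p|}{mB(p)}}\,\big(e^{-itL_0}f_{odd}\big)(q,p),$$ where $f_{odd}(q,p):=f(q,p)-f(-q,-p)$. -/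

import Mathlib

open MeasureTheory Filter Topology
open scoped ContDiff

noncomputable section

/-- The Hilbert space `L²(ℝ²)` of phase-space functions; a point of `ℝ × ℝ` is `(q, p)`. -/
abbrev PhaseL2 : Type := Lp ℂ 2 (volume : Measure (ℝ × ℝ))

/-- The Heaviside function. -/
def heaviside (x : ℝ) : ℝ := if 0 < x then 1 else 0

/-- `h = -i (p/m) ∂_q f` in the sense of distributions on `ℝ²`. -/
def IsWeakL0 (m : ℝ) (f h : ℝ × ℝ → ℂ) : Prop :=
  ∀ η : ℝ × ℝ → ℂ, ContDiff ℝ ∞ η → HasCompactSupport η →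
    ∫ x, h x * η x = ∫ x, f x * (Complex.I * ((x.2 / m : ℝ) : ℂ) * fderiv ℝ η x (1, 0))

theorem integrable_L2_mul (f : PhaseL2) {χ : ℝ × ℝ → ℂ} (hχ : Continuous χ)
    (hs : HasCompactSupport χ) : Integrable (fun x => f x * χ x) :=
  (Lp.memLp f).integrable_mul (q := 2) (hχ.memLp_of_hasCompactSupport hs)

theorem integrable_L2_mul_deriv (m : ℝ) (f : PhaseL2) {η : ℝ × ℝ → ℂ} (hη : ContDiff ℝ ∞ η)
    (hs : HasCompactSupport η) :
    Integrable (fun x => f x * (Complex.I * ((x.2 / m : ℝ) : ℂ) * fderiv ℝ η x (1, 0))) := by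
  have hc : Continuous fun x => fderiv ℝ η x (1, 0) :=
    (hη.continuous_fderiv (by simp)).clm_apply continuous_const
  refine integrable_L2_mul f (by fun_prop) ?_
  exact (hs.fderiv_apply ℝ (1, 0)).mul_left

/-- The graph of `L₀ = -i (p/m) ∂_q` on its maximal domain in `L²(ℝ²)`. -/
def graphL0 (m : ℝ) : Submodule ℂ (PhaseL2 × PhaseL2) where
  carrier := {u | IsWeakL0 m u.1 u.2}
  zero_mem' := by
    intro η hη hs
    have h0 := Lp.coeFn_zero ℂ 2 (volume : Measure (ℝ × ℝ))
    have e1 : ∫ x, (0 : PhaseL2 × PhaseL2).2 x * η x = 0 := by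
      refine integral_eq_zero_of_ae ?_
      filter_upwards [h0] with x hx
      simp only [Prod.snd_zero, hx, Pi.zero_apply, zero_mul]
    have e2 : ∫ x, (0 : PhaseL2 × PhaseL2).1 x *
        (Complex.I * ((x.2 / m : ℝ) : ℂ) * fderiv ℝ η x (1, 0)) = 0 := by
      refine integral_eq_zero_of_ae ?_
      filter_upwards [h0] with x hx
      simp only [Prod.fst_zero, hx, Pi.zero_apply, zero_mul]
    rw [e1, e2]
  add_mem' := by
    intro u v hu hv η hη hs
    have e1 : ∫ x, (u + v).2 x * η x = ∫ x, (u.2 x * η x + v.2 x * η x) := by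
      refine integral_congr_ae ?_
      filter_upwards [Lp.coeFn_add u.2 v.2] with x hx
      simp only [Prod.snd_add, hx, Pi.add_apply, add_mul]
    have e2 : ∫ x, (u + v).1 x * (Complex.I * ((x.2 / m : ℝ) : ℂ) * fderiv ℝ η x (1, 0)) =
        ∫ x, (u.1 x * (Complex.I * ((x.2 / m : ℝ) : ℂ) * fderiv ℝ η x (1, 0)) +
          v.1 x * (Complex.I * ((x.2 / m : ℝ) : ℂ) * fderiv ℝ η x (1, 0))) := by
      refine integral_congr_ae ?_
      filter_upwards [Lp.coeFn_add u.1 v.1] with x hx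
      simp only [Prod.fst_add, hx, Pi.add_apply, add_mul]
    rw [e1, e2, integral_add (integrable_L2_mul _ hη.continuous hs)
      (integrable_L2_mul _ hη.continuous hs), integral_add (integrable_L2_mul_deriv m _ hη hs)
      (integrable_L2_mul_deriv m _ hη hs), hu η hη hs, hv η hη hs]
  smul_mem' := by
    intro c u hu η hη hs
    have e1 : ∫ x, (c • u).2 x * η x = ∫ x, c * (u.2 x * η x) := by
      refine integral_congr_ae ?_
      filter_upwards [Lp.coeFn_smul c u.2] with x hx
      simp only [Prod.smul_snd, hx, Pi.smul_apply, smul_eq_mul, mul_assoc]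
    have e2 : ∫ x, (c • u).1 x * (Complex.I * ((x.2 / m : ℝ) : ℂ) * fderiv ℝ η x (1, 0)) =
        ∫ x, c * (u.1 x * (Complex.I * ((x.2 / m : ℝ) : ℂ) * fderiv ℝ η x (1, 0))) := by
      refine integral_congr_ae ?_
      filter_upwards [Lp.coeFn_smul c u.1] with x hx
      simp only [Prod.smul_fst, hx, Pi.smul_apply, smul_eq_mul, mul_assoc]
    rw [e1, e2, integral_const_mul, integral_const_mul, hu η hη hs]

theorem graphL0_single_valued (m : ℝ) (u : PhaseL2 × PhaseL2) (hu : u ∈ graphL0 m)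
    (h0 : u.1 = 0) : u.2 = 0 := by
  rw [Lp.eq_zero_iff_ae_eq_zero]
  refine ae_eq_zero_of_integral_contDiff_smul_eq_zero
    ((Lp.memLp u.2).locallyIntegrable (by norm_num)) ?_
  intro g hg hs
  have h := hu (fun x => (g x : ℂ)) (Complex.ofRealCLM.contDiff.comp hg)
    (hs.comp_left (g := fun r : ℝ => (r : ℂ)) (by simp))
  have e : ∫ x, u.1 x * (Complex.I * ((x.2 / m : ℝ) : ℂ) *
      fderiv ℝ (fun x => (g x : ℂ)) x (1, 0)) = 0 := by
    refine integral_eq_zero_of_ae ?_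
    rw [h0]
    filter_upwards [Lp.coeFn_zero ℂ 2 (volume : Measure (ℝ × ℝ))] with x hx
    simp only [hx, Pi.zero_apply, zero_mul]
  rw [← h.trans e]
  refine integral_congr_ae (ae_of_all _ fun x => ?_)
  simp [mul_comm]

/-- The free Liouville operator `L₀ = -i (p/m) ∂_q` with its maximal domain. -/
def L0 (m : ℝ) : PhaseL2 →ₗ.[ℂ] PhaseL2 := (graphL0 m).toLinearPMap

theorem L0_graph (m : ℝ) : (L0 m).graph = graphL0 m :=
  Submodule.toLinearPMap_graph_eq _ (graphL0_single_valued m)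

/-- `φ = γ f`, the trace `(γ f)(p) = f(0, p)`: the class `f` has a representative which for almost
every `p` is continuous in `q`, and `φ(p)` is the value of that representative at `q = 0`. Such a
representative exists for `f ∈ dom L₀` (where `f(·, p) ∈ H¹(ℝ)` for almost every `p`), and its
value at `q = 0` is unique up to null sets of `p`. -/
def IsTrace (f : ℝ × ℝ → ℂ) (φ : ℝ → ℂ) : Prop :=
  ∃ F : ℝ × ℝ → ℂ, f =ᵐ[volume] F ∧ (∀ᵐ p : ℝ, Continuous fun q => F (q, p)) ∧
    ∀ᵐ p : ℝ, φ p = F (0, p)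

/-- The kernel `g_z(q, p)` of the free resolvent `(L₀ - z)⁻¹`. -/
def gKer (m : ℝ) (z : ℂ) (x : ℝ × ℝ) : ℂ :=
  (heaviside (x.1 * x.2 * z.im) : ℂ) * (Real.sign z.im : ℂ) * (Complex.I * m / |x.2|) *
    Complex.exp (Complex.I * m * z * x.1 / x.2)

/-- `(G_z φ)(q, p) = g_z(q, p) φ(p)`. -/
def Gop (m : ℝ) (z : ℂ) (φ : ℝ → ℂ) (x : ℝ × ℝ) : ℂ := gKer m z x * φ x.2

/-- The function `B : ℝ → ℝ ∪ {∞}`, `B(p) = b p²` for real `b` and `B(p) = ∞` for `b = ∞`. -/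
def Bfun (b : OnePoint ℝ) (p : ℝ) : OnePoint ℝ :=
  b.elim OnePoint.infty fun r => ((r * p ^ 2 : ℝ) : OnePoint ℝ)

/-- The reciprocal on `ℝ ∪ {∞}`, with `1/∞ = 0`. -/
def recip (a : OnePoint ℝ) : ℝ := a.elim 0 fun r => r⁻¹

/-- `(Λ_z^B φ)(p) = φ(p) / (1/B(p) - sgn(Im z) i m / (2|p|))`. -/
def Lam (m : ℝ) (b : OnePoint ℝ) (z : ℂ) (φ : ℝ → ℂ) (p : ℝ) : ℂ :=
  φ p / ((recip (Bfun b p) : ℂ) - (Real.sign z.im : ℂ) * (Complex.I * m / (2 * |p|)))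

/-- The projector `Π'` onto odd functions of `p`. -/
def oddProj (φ : ℝ → ℂ) (p : ℝ) : ℂ := (1 / 2) * (φ p - φ (-p))

/-- The graph of `L_B`: the pairs `(f, h)` with `f = f_z + G_z Λ_z^B Π' γ f_z`, `f_z ∈ dom L₀`,
and `h - z f = (L₀ - z) f_z`. -/
def graphLB (m : ℝ) (b : OnePoint ℝ) (z : ℂ) : Submodule ℂ (PhaseL2 × PhaseL2) where
  carrier := {u | ∃ (fz : (L0 m).domain) (φ : ℝ → ℂ), IsTrace (fz : PhaseL2) φ ∧
    (u.1 =ᵐ[volume] fun x => (fz : PhaseL2) x + Gop m z (Lam m b z (oddProj φ)) x) ∧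
    u.2 - z • u.1 = L0 m fz - z • (fz : PhaseL2)}
  zero_mem' := by
    have h0 := Lp.coeFn_zero ℂ 2 (volume : Measure (ℝ × ℝ))
    refine ⟨0, 0, ⟨0, by simpa using h0, ?_, ?_⟩, ?_, by simp⟩
    · exact ae_of_all _ fun p => continuous_const
    · exact ae_of_all _ fun p => rfl
    · filter_upwards with x
      simp [Gop, Lam, oddProj]
  add_mem' := by
    rintro u v ⟨f, φ, ⟨F, hF1, hF2, hF3⟩, hu, hu'⟩ ⟨g, ψ, ⟨G, hG1, hG2, hG3⟩, hv, hv'⟩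
    refine ⟨f + g, φ + ψ, ⟨F + G, ?_, ?_, ?_⟩, ?_, ?_⟩
    · exact (Lp.coeFn_add _ _).trans (hF1.add hG1)
    · filter_upwards [hF2, hG2] with p h1 h2 using h1.add h2
    · filter_upwards [hF3, hG3] with p h1 h2
      simp [h1, h2]
    · filter_upwards [hu, hv, Lp.coeFn_add u.1 v.1, Lp.coeFn_add (f : PhaseL2) g] with x h1 h2 h3 h4
      simp only [Prod.fst_add, Submodule.coe_add, h3, h4, Pi.add_apply, h1, h2, Gop, Lam, oddProj]
      ring
    · rw [LinearPMap.map_add, Submodule.coe_add, Prod.snd_add, Prod.fst_add, smul_add, smul_add,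
        add_sub_add_comm, add_sub_add_comm, hu', hv']
  smul_mem' := by
    rintro c u ⟨f, φ, ⟨F, hF1, hF2, hF3⟩, hu, hu'⟩
    refine ⟨c • f, c • φ, ⟨c • F, ?_, ?_, ?_⟩, ?_, ?_⟩
    · exact (Lp.coeFn_smul _ _).trans (hF1.const_smul c)
    · filter_upwards [hF2] with p h1 using h1.const_smul c
    · filter_upwards [hF3] with p h1
      simp [h1]
    · filter_upwards [hu, Lp.coeFn_smul c u.1, Lp.coeFn_smul c (f : PhaseL2)] with x h1 h3 h4
      simp only [Prod.smul_fst, Submodule.coe_smul, h3, h4, Pi.smul_apply, h1, Gop, Lam, oddProj,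
        smul_eq_mul]
      ring
    · rw [LinearPMap.map_smul, Submodule.coe_smul, Prod.smul_snd, Prod.smul_fst, smul_comm z c,
        smul_comm z c, ← smul_sub, ← smul_sub, hu']

theorem eq_zero_of_continuous_jump {F : ℝ → ℂ} (hF : Continuous F) {m p : ℝ} (hm : m ≠ 0)
    (hp : p ≠ 0) {z : ℂ} (hz : z.im ≠ 0) {c : ℂ} (h : ∀ᵐ q : ℝ, 0 = F q + gKer m z (q, p) * c) :
    c = 0 := by
  have hs : p * z.im ≠ 0 := mul_ne_zero hp hz
  set E : ℝ → ℂ := fun q => (Real.sign z.im : ℂ) * (Complex.I * m / |p|) *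
    Complex.exp (Complex.I * m * z * q / p) * c with hE
  have hEc : Continuous E := by fun_prop
  have key : ∀ s : Set ℝ, IsOpen s → (0 : ℝ) ∈ closure s → ∀ G : ℝ → ℂ, Continuous G →
      (∀ q ∈ s, gKer m z (q, p) * c = G q) → F 0 + G 0 = 0 := by
    intro s hs h0 G hG hsG
    have h1 : (fun q => F q + G q) =ᵐ[volume.restrict s] fun _ => 0 := by
      filter_upwards [ae_restrict_of_ae h, ae_restrict_mem hs.measurableSet] with q h1 h2
      rw [← hsG q h2, ← h1]
    have h2 := Measure.eqOn_open_of_ae_eq h1 hs (by fun_prop) (by fun_prop)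
    exact h2.closure (by fun_prop) (by fun_prop) h0
  have hpos : ∀ q, 0 < q * p * z.im → gKer m z (q, p) * c = E q := by
    intro q hq
    simp [gKer, heaviside, hq, hE]
  have hneg : ∀ q, q * p * z.im < 0 → gKer m z (q, p) * c = 0 := by
    intro q hq
    simp [gKer, heaviside, not_lt.mpr hq.le]
  have hIoi : (0 : ℝ) ∈ closure (Set.Ioi (0 : ℝ)) := by simp
  have hIio : (0 : ℝ) ∈ closure (Set.Iio (0 : ℝ)) := by simp
  have hfin : F 0 + E 0 = 0 ∧ F 0 + 0 = 0 := by
    rcases lt_or_gt_of_ne hs with hs | hs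
    · refine ⟨key _ isOpen_Iio hIio E hEc fun q hq => hpos q ?_,
        key _ isOpen_Ioi hIoi (fun _ => 0) continuous_const fun q hq => hneg q ?_⟩
      · rw [mul_assoc]
        exact mul_pos_of_neg_of_neg hq hs
      · rw [mul_assoc]
        exact mul_neg_of_pos_of_neg hq hs
    · refine ⟨key _ isOpen_Ioi hIoi E hEc fun q hq => hpos q ?_,
        key _ isOpen_Iio hIio (fun _ => 0) continuous_const fun q hq => hneg q ?_⟩
      · rw [mul_assoc]
        exact mul_pos hq hs
      · rw [mul_assoc]
        exact mul_neg_of_neg_of_pos hq hs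
  have hE0 : E 0 = 0 := by
    have h1 := hfin.1
    have h2 := hfin.2
    rw [add_zero] at h2
    rwa [h2, zero_add] at h1
  simpa [hE, hm, hp, Real.sign_eq_zero_iff, hz] using hE0

theorem graphLB_single_valued {m : ℝ} (hm : m ≠ 0) (b : OnePoint ℝ) {z : ℂ} (hz : z.im ≠ 0)
    (u : PhaseL2 × PhaseL2) (hu : u ∈ graphLB m b z) (h0 : u.1 = 0) : u.2 = 0 := by
  obtain ⟨f, φ, ⟨F, hF1, hF2, -⟩, hu, hu'⟩ := hu
  set ψ := Lam m b z (oddProj φ) with hψ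
  have h1 : ∀ᵐ x : ℝ × ℝ, 0 = F x + gKer m z x * ψ x.2 := by
    rw [h0] at hu
    filter_upwards [hu, hF1, Lp.coeFn_zero ℂ 2 (volume : Measure (ℝ × ℝ))] with x h1 h2 h3
    rw [← h2]
    exact (h1.symm.trans h3).symm
  have h2 : ∀ᵐ p : ℝ, ∀ᵐ q : ℝ, 0 = F (q, p) + gKer m z (q, p) * ψ p := by
    have := (Measure.measurePreserving_swap (μ := (volume : Measure ℝ))
      (ν := (volume : Measure ℝ))).quasiMeasurePreserving.ae h1
    exact Measure.ae_ae_of_ae_prod this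
  have h3 : ∀ᵐ p : ℝ, ψ p = 0 := by
    filter_upwards [h2, hF2, Measure.ae_ne volume (0 : ℝ)] with p h2 h3 h4
    exact eq_zero_of_continuous_jump h3 hm h4 hz h2
  have h4 : (f : PhaseL2) = 0 := by
    rw [Lp.eq_zero_iff_ae_eq_zero]
    have h5 : ∀ᵐ x : ℝ × ℝ, ψ x.2 = 0 := Measure.quasiMeasurePreserving_snd.ae h3
    filter_upwards [h1, h5, hF1] with x h1 h5 h6
    rw [h6, Pi.zero_apply, h1, h5, mul_zero, add_zero]
  have h5 : f = 0 := Subtype.ext h4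
  rw [h5, h0] at hu'
  simpa using hu'

/-- The operator `L_B` with `dom L_B = {f | f = f_z + G_z Λ_z^B Π' γ f_z, f_z ∈ dom L₀}` and
`(L_B - z) f = (L₀ - z) f_z`. -/
def LB (m : ℝ) (b : OnePoint ℝ) (z : ℂ) : PhaseL2 →ₗ.[ℂ] PhaseL2 := (graphLB m b z).toLinearPMap

theorem LB_graph {m : ℝ} (hm : m ≠ 0) (b : OnePoint ℝ) {z : ℂ} (hz : z.im ≠ 0) :
    (LB m b z).graph = graphLB m b z :=
  Submodule.toLinearPMap_graph_eq _ (graphLB_single_valued hm b hz)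

/-- `U t = e^{-itA}`: `U` is a strongly continuous one-parameter unitary group whose generator
(the strong derivative at `t = 0`, with its full domain of existence) is `-iA`. -/
structure IsUnitaryGroup (A : PhaseL2 →ₗ.[ℂ] PhaseL2) (U : ℝ → PhaseL2 ≃ₗᵢ[ℂ] PhaseL2) : Prop where
  map_zero : ∀ f, U 0 f = f
  map_add : ∀ s t f, U (s + t) f = U s (U t f)
  continuous : ∀ f, Continuous fun t => U t f
  generator : ∀ f h, (f, h) ∈ A.graph ↔
    Tendsto (fun t : ℝ => (t : ℂ)⁻¹ • (U t f - f)) (𝓝[≠] 0) (𝓝 (-Complex.I • h))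

/-- The free translation `f(q - p t / m, p)`. -/
def freeFlow (m t : ℝ) (f : ℝ × ℝ → ℂ) (x : ℝ × ℝ) : ℂ := f (x.1 - x.2 * t / m, x.2)

/-- `f_odd(q, p) = f(q, p) - f(-q, -p)`. -/
def fOdd (f : ℝ × ℝ → ℂ) (x : ℝ × ℝ) : ℂ := f x - f (-x.1, -x.2)

end

/-! The perturbed group is the free group conjugated by an explicit unitary. Put `kappa` κ(p) =
2|p|/(mB(p)) and w(q,p) = θ(qp)/(1 - iκ(p)), and let W f = f - w f_odd. Since w is even, W fixes the
functions that are even under x ↦ -x and multiplies the odd ones by 1 - 2w. This factor has modulus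
one, so W is unitary and its inverse uses the conjugate of w. The set qp > 0 is the outgoing region:
W leaves incoming points alone and attaches the scattering phase to outgoing ones.

The free flow commutes with x ↦ -x, so W⁻¹ e^{-itL₀} W multiplies the transported odd part by (1 -
2w(y))(1 - 2 conj w(x)), where y is the point from which the flow reaches x. If x and y lie on the
same side of q = 0 the two factors cancel; if the trajectory crosses q = 0, exactly one survives.
This is the stated formula (`waveMult_combination`, `perturbedGroup_ae`).

It remains to see that this group has generator -iL_B. For any unitary group, a pair (f, h) is in
the graph of the operator exactly when f = R(z)(h - zf), where R(z) is the Laplace transform of the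
group (`hasDerivAt_iff_eq_laplaceResolvent`). For the explicit group this transform can be computed
pointwise: the scattered term only contributes after the passage through q = 0, and measuring time
from that passage produces g_z times the trace of the free resolvent, i.e. the formula defining L_B
(`perturbed_resolvent_apply`, `mem_graphLB_iff`). Hence self-adjointness of L_B never has to be
proved separately. The free generator is identified by a weak-to-strong argument, and a unitary
group is determined by its generator, which covers arbitrary U₀ and U. -/

noncomputable section

/-! ### Unitary groups on a Hilbert space: differentiability of orbits and uniqueness -/

/-- A strongly continuous one-parameter unitary group on a Hilbert space. -/
structure IsUnitaryFlow {H : Type*} [NormedAddCommGroup H] [InnerProductSpace ℂ H]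
    (U : ℝ → H ≃ₗᵢ[ℂ] H) : Prop where
  map_zero : ∀ f, U 0 f = f
  map_add : ∀ s t f, U (s + t) f = U s (U t f)
  continuous : ∀ f, Continuous fun t => U t f

theorem IsUnitaryGroup.isUnitaryFlow {A : PhaseL2 →ₗ.[ℂ] PhaseL2}
    {U : ℝ → PhaseL2 ≃ₗᵢ[ℂ] PhaseL2} (h : IsUnitaryGroup A U) : IsUnitaryFlow U :=
  ⟨h.map_zero, h.map_add, h.continuous⟩

section UnitaryFlow

variable {H : Type*} [NormedAddCommGroup H] [InnerProductSpace ℂ H]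
  {U : ℝ → H ≃ₗᵢ[ℂ] H}

theorem tendsto_slope_iff_hasDerivAt (h0 : ∀ f, U 0 f = f)
    (f g : H) :
    Tendsto (fun t : ℝ => (t : ℂ)⁻¹ • (U t f - f)) (𝓝[≠] 0) (𝓝 g) ↔
      HasDerivAt (fun t => U t f) g 0 := by
  rw [hasDerivAt_iff_tendsto_slope_zero]
  refine tendsto_congr fun t => ?_
  rw [zero_add, h0, ← Complex.coe_smul, Complex.ofReal_inv]

namespace IsUnitaryFlow


theorem hasDerivAt (hU : IsUnitaryFlow U) {f g : H}
    (h : HasDerivAt (fun t => U t f) g 0) (t : ℝ) : HasDerivAt (fun t => U t f) (U t g) t := by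
  have h1 : HasDerivAt (fun s => U (s - t) f) g t := by
    have := HasDerivAt.comp_sub_const (f := fun t => U t f) (f' := g) t t (by simpa using h)
    exact this
  have h2 := ((U t).toContinuousLinearEquiv.toContinuousLinearMap.restrictScalars
    ℝ).hasFDerivAt.comp_hasDerivAt t h1
  refine (h2.congr_of_eventuallyEq (Eventually.of_forall fun s => ?_))
  simp [← hU.map_add]

theorem hasDerivAt_map (hU : IsUnitaryFlow U) {f g : H}
    (h : HasDerivAt (fun t => U t f) g 0) (t : ℝ) :
    HasDerivAt (fun s => U s (U t f)) (U t g) 0 := by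
  have h1 := HasDerivAt.comp_add_const (f := fun t => U t f) (f' := U t g) 0 t
    (by simpa using hU.hasDerivAt h t)
  simpa only [hU.map_add] using h1

/-- Skew-symmetry of the generator: ⟨U t f, U t f⟩ is constant in t, so its derivative vanishes. -/
theorem inner_add_inner_eq_zero (hU : IsUnitaryFlow U) {f g : H}
    (h : HasDerivAt (fun t => U t f) g 0) : inner ℂ f g + inner ℂ g f = 0 := by
  have h1 := h.inner ℂ h
  simp only [LinearIsometryEquiv.inner_map_map, hU.map_zero] at h1
  exact h1.unique (hasDerivAt_const _ _)

variable [CompleteSpace H]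

theorem hasDerivAt_integral (hU : IsUnitaryFlow U) (f : H) (a : ℝ) :
    HasDerivAt (fun r => U r (∫ s in (0 : ℝ)..a, U s f)) (U a f - f) 0 := by
  have h1 : ∀ r, U r (∫ s in (0 : ℝ)..a, U s f) = ∫ s in r..(a + r), U s f := by
    intro r
    have := ((U r).toContinuousLinearEquiv.toContinuousLinearMap).intervalIntegral_comp_comm
      (μ := volume) (a := 0) (b := a) ((hU.continuous f).intervalIntegrable 0 a)
    simp only [ContinuousLinearEquiv.coe_coe, LinearIsometryEquiv.coe_toContinuousLinearEquiv]
      at this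
    rw [← this]
    simp only [← hU.map_add]
    rw [intervalIntegral.integral_comp_add_left (fun s => U s f)]
    simp [add_comm]
  have h2 : ∀ r, ∫ s in r..(a + r), U s f =
      (∫ s in (0 : ℝ)..(a + r), U s f) - ∫ s in (0 : ℝ)..r, U s f := fun r =>
    (intervalIntegral.integral_interval_sub_left ((hU.continuous f).intervalIntegrable _ _)
      ((hU.continuous f).intervalIntegrable _ _)).symm
  simp only [h1, h2]
  have h3 : ∀ x, HasDerivAt (fun r => ∫ s in (0 : ℝ)..r, U s f) (U x f) x := fun x =>
    (hU.continuous f).integral_hasStrictDerivAt 0 x |>.hasDerivAt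
  have h4 := HasDerivAt.comp_const_add (f := fun r => ∫ s in (0 : ℝ)..r, U s f) (f' := U a f) a 0
    (by simpa using h3 a)
  have h5 := h3 0
  rw [hU.map_zero] at h5
  exact h4.sub h5

/-- The averages (1/t)∫₀ᵗ U s f ds have differentiable orbits, by `hasDerivAt_integral`, and tend to
f as t → 0. -/
theorem dense_differentiable (hU : IsUnitaryFlow U) :
    Dense {f : H | ∃ g, HasDerivAt (fun t => U t f) g 0} := by
  intro f
  have h3 : HasDerivAt (fun r => ∫ s in (0 : ℝ)..r, U s f) f 0 := by
    simpa [hU.map_zero] using ((hU.continuous f).integral_hasStrictDerivAt 0 0).hasDerivAt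
  rw [hasDerivAt_iff_tendsto_slope_zero] at h3
  refine mem_closure_of_tendsto h3 (Eventually.of_forall fun t => ?_)
  refine ⟨t⁻¹ • (U t f - f), ?_⟩
  have := (hU.hasDerivAt_integral f t).const_smul t⁻¹
  refine this.congr_of_eventuallyEq (Eventually.of_forall fun r => ?_)
  simp only [zero_add, intervalIntegral.integral_same, sub_zero, ← Complex.coe_smul, map_smul,
    Pi.smul_apply]

/-- For f in the common domain, the difference U s f - V s f stays in the domain and solves the
evolution equation. By skew-symmetry its norm is constant, and it vanishes at s = 0. Density extends
the equality to all f. -/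
theorem unique (hU : IsUnitaryFlow U) {V : ℝ → H ≃ₗᵢ[ℂ] H} (hV : IsUnitaryFlow V)
    (hUV : ∀ f g, HasDerivAt (fun t => U t f) g 0 ↔ HasDerivAt (fun t => V t f) g 0) (t : ℝ)
    (f : H) : U t f = V t f := by
  refine congr_fun (Continuous.ext_on hU.dense_differentiable (U t).continuous
    (V t).continuous ?_) f
  rintro f ⟨g, hg⟩
  have hg' := (hUV _ _).1 hg
  have hd : ∀ s, HasDerivAt (fun s => U s f - V s f) (U s g - V s g) s := fun s =>
    (hU.hasDerivAt hg s).sub (hV.hasDerivAt hg' s)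
  have hz : ∀ s, HasDerivAt
      (fun s => inner ℂ (U s f - V s f) (U s f - V s f)) (0 : ℂ) s := by
    intro s
    have h1 : HasDerivAt (fun r => U r (U s f - V s f)) (U s g - V s g) 0 := by
      simp only [map_sub]
      exact (hU.hasDerivAt_map hg s).sub ((hUV _ _).2 (hV.hasDerivAt_map hg' s))
    have h2 := (hd s).inner ℂ (hd s)
    rwa [hU.inner_add_inner_eq_zero h1] at h2
  have hc := is_const_of_deriv_eq_zero (fun s => (hz s).differentiableAt) (fun s => (hz s).deriv)
    t 0
  simp only [hU.map_zero, hV.map_zero, sub_self, inner_zero_left] at hc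
  exact sub_eq_zero.1 (inner_self_eq_zero.1 hc)

/-- Weak differentiability along every orbit point, tested on a separating family of functionals,
implies strong differentiability. -/
theorem hasDerivAt_of_weak (hU : IsUnitaryFlow U) {ι : Type*} (l : ι → H →L[ℂ] ℂ)
    (hl : ∀ f, (∀ i, l i f = 0) → f = 0) {f g : H}
    (h : ∀ i t, HasDerivAt (fun t => l i (U t f)) (l i (U t g)) t) :
    HasDerivAt (fun t => U t f) g 0 := by
  -- The fundamental theorem of calculus holds after applying each functional; separation lifts it
  -- to a vector identity, whose right side is strongly differentiable.
  have h1 : ∀ t, U t f = f + ∫ s in (0 : ℝ)..t, U s g := by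
    intro t
    rw [← sub_eq_zero]
    refine hl _ fun i => ?_
    have hc : Continuous fun s => l i (U s g) := (l i).continuous.comp (hU.continuous g)
    have h2 := intervalIntegral.integral_eq_sub_of_hasDerivAt (fun s _ => h i s)
      (hc.intervalIntegrable 0 t)
    have h3 := (l i).intervalIntegral_comp_comm (μ := volume)
      ((hU.continuous g).intervalIntegrable 0 t)
    rw [map_sub, _root_.map_add, ← h3, h2, hU.map_zero]
    ring
  have h4 := ((hU.continuous g).integral_hasStrictDerivAt 0 0).hasDerivAt.const_add f
  rw [hU.map_zero] at h4
  exact h4.congr_of_eventuallyEq (Eventually.of_forall h1)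

end IsUnitaryFlow

/-! ### The resolvent as a Laplace transform of the group -/

/-- The resolvent `(A - z)⁻¹ = i σ ∫₀^∞ e^{iσzs} U(σ s) ds`, `σ = sgn (Im z)`, of the self-adjoint
operator `A` with `U t = e^{-itA}`. -/
def laplaceResolvent (U : ℝ → H ≃ₗᵢ[ℂ] H) (z : ℂ) (g : H) : H :=
  (Complex.I * (Real.sign z.im : ℂ)) • ∫ s in Set.Ioi (0 : ℝ),
    Complex.exp (Complex.I * (Real.sign z.im : ℂ) * z * s) • U (Real.sign z.im * s) g

theorem re_I_mul_sign_mul_neg {z : ℂ} (hz : z.im ≠ 0) :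
    (Complex.I * (Real.sign z.im : ℂ) * z).re < 0 := by
  rcases lt_or_gt_of_ne hz with h | h
  · simp [Real.sign_of_neg h, h]
  · simp [Real.sign_of_pos h, h]

theorem sign_mul_sign_self {x : ℝ} (hx : x ≠ 0) : Real.sign x * Real.sign x = 1 := by
  rcases lt_or_gt_of_ne hx with h | h
  · simp [Real.sign_of_neg h]
  · simp [Real.sign_of_pos h]

namespace IsUnitaryFlow


theorem continuous_laplace (hU : IsUnitaryFlow U) (w : ℂ) (σ : ℝ) (g : H) :
    Continuous fun s : ℝ => Complex.exp (w * s) • U (σ * s) g := by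
  have h1 : Continuous fun s : ℝ => Complex.exp (w * s) := by fun_prop
  exact h1.smul ((hU.continuous g).comp (continuous_const.mul continuous_id))

theorem integrableOn_laplace (hU : IsUnitaryFlow U) {w : ℂ} (hw : w.re < 0) (σ : ℝ)
    (g : H) (a : ℝ) :
    IntegrableOn (fun s : ℝ => Complex.exp (w * s) • U (σ * s) g) (Set.Ioi a) := by
  have h1 := (integrableOn_exp_mul_complex_Ioi hw a).norm.mul_const ‖g‖
  refine Integrable.mono' h1 (hU.continuous_laplace w σ g).aestronglyMeasurable
    (ae_of_all _ fun s => ?_)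
  rw [norm_smul, LinearIsometryEquiv.norm_map]

variable [CompleteSpace H]

theorem apply_laplaceResolvent (hU : IsUnitaryFlow U) {z : ℂ} (hz : z.im ≠ 0) (g : H)
    (l : H →L[ℂ] ℂ) :
    l (laplaceResolvent U z g) = Complex.I * (Real.sign z.im : ℂ) * ∫ s in Set.Ioi (0 : ℝ),
      Complex.exp (Complex.I * (Real.sign z.im : ℂ) * z * s) * l (U (Real.sign z.im * s) g) := by
  have h1 := l.integral_comp_comm
    (hU.integrableOn_laplace (re_I_mul_sign_mul_neg hz) (Real.sign z.im) g 0)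
  simp only [map_smul, smul_eq_mul] at h1
  rw [h1, laplaceResolvent, map_smul, smul_eq_mul]

/-- Translating the time variable turns the integral over (0, ∞) into e^{-wt} times the integral
over (t, ∞), with w = iσz. The right side is visibly differentiable in t. -/
theorem map_laplaceResolvent (hU : IsUnitaryFlow U) {z : ℂ} (hz : z.im ≠ 0) (g : H)
    (t : ℝ) :
    U (Real.sign z.im * t) (laplaceResolvent U z g) =
      Complex.exp (-(Complex.I * (Real.sign z.im : ℂ) * z) * t) • (laplaceResolvent U z g -
        (Complex.I * (Real.sign z.im : ℂ)) • ∫ s in (0 : ℝ)..t,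
          Complex.exp (Complex.I * (Real.sign z.im : ℂ) * z * s) • U (Real.sign z.im * s) g) := by
  have hw := re_I_mul_sign_mul_neg hz
  unfold laplaceResolvent
  set σ := Real.sign z.im
  set w := Complex.I * (σ : ℂ) * z with hwdef
  have hInt := fun a => hU.integrableOn_laplace hw σ g a
  rw [← smul_sub, ← intervalIntegral.integral_Ioi_sub_Ioi' (hInt 0) (hInt t), sub_sub_cancel,
    map_smul, smul_comm]
  congr 1
  have h1 := ((U (σ * t)).toContinuousLinearEquiv.toContinuousLinearMap).integral_comp_comm (hInt 0)
  simp only [ContinuousLinearEquiv.coe_coe, LinearIsometryEquiv.coe_toContinuousLinearEquiv] at h1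
  rw [← h1, ← integral_smul]
  have h2 := (measurePreserving_add_right volume t).setIntegral_preimage_emb
    (measurableEmbedding_addRight t) (fun s : ℝ =>
    Complex.exp (-w * t) • Complex.exp (w * s) • U (σ * s) g) (Set.Ioi t)
  rw [← h2, Set.preimage_add_const_Ioi, sub_self]
  refine setIntegral_congr_fun measurableSet_Ioi fun s _ => ?_
  simp only [map_smul, ← hU.map_add, smul_smul, ← Complex.exp_add]
  congr 2
  · push_cast; ring
  · ring_nf

/-- Forwards, e^{ws} U(σs) f has derivative -iσ e^{ws} U(σs)(h - zf) and decays at infinity;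
integrate over (0, ∞). Backwards, differentiate `map_laplaceResolvent` at t = 0. -/
theorem hasDerivAt_iff_eq_laplaceResolvent (hU : IsUnitaryFlow U) {z : ℂ} (hz : z.im ≠ 0)
    (f h : H) :
    HasDerivAt (fun t => U t f) (-Complex.I • h) 0 ↔ f = laplaceResolvent U z (h - z • f) := by
  have hw := re_I_mul_sign_mul_neg hz
  have hσ := sign_mul_sign_self hz
  have hσc : (Real.sign z.im : ℂ) * (Real.sign z.im : ℂ) = 1 := by exact_mod_cast hσ
  have hexp : ∀ (w : ℂ) (s : ℝ), HasDerivAt (fun s : ℝ => Complex.exp (w * s))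
      (w * Complex.exp (w * s)) s := by
    intro w s
    have h2 : HasDerivAt (fun s : ℝ => w * (s : ℂ)) w s := by
      simpa using (Complex.ofRealCLM.hasDerivAt (x := s)).const_mul w
    simpa [mul_comm] using h2.cexp
  constructor
  · intro hd
    have h1 : ∀ s : ℝ, HasDerivAt (fun s : ℝ => U (Real.sign z.im * s) f)
        (Real.sign z.im • U (Real.sign z.im * s) (-Complex.I • h)) s := by
      intro s
      have h2 : HasDerivAt (fun s : ℝ => Real.sign z.im * s) (Real.sign z.im) s := by
        simpa using (hasDerivAt_id s).const_mul (Real.sign z.im)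
      exact (hU.hasDerivAt hd _).scomp s h2
    set σ := Real.sign z.im with hσdef
    set w := Complex.I * (σ : ℂ) * z with hwdef
    have h3 : ∀ s ∈ Set.Ici (0 : ℝ), HasDerivAt
        (fun s : ℝ => Complex.exp (w * s) • U (σ * s) f)
        (-(Complex.I * σ) • (Complex.exp (w * s) • U (σ * s) (h - z • f))) s := by
      intro s _
      have h4 := (hexp w s).smul (h1 s)
      refine h4.congr_deriv ?_
      simp only [map_sub, map_smul, smul_sub, smul_smul, ← Complex.coe_smul]
      rw [hwdef]
      module
    have h5 : Tendsto (fun s : ℝ => Complex.exp (w * s) • U (σ * s) f) atTop (𝓝 0) := by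
      rw [tendsto_zero_iff_norm_tendsto_zero]
      simp only [norm_smul, LinearIsometryEquiv.norm_map, Complex.norm_exp]
      rw [← zero_mul ‖f‖]
      refine Tendsto.mul_const _ (Real.tendsto_exp_atBot.comp ?_)
      simpa using tendsto_id.const_mul_atTop_of_neg hw
    have h6 := integral_Ioi_of_hasDerivAt_of_tendsto' h3
      ((hU.integrableOn_laplace hw σ _ 0).smul _) h5
    rw [integral_smul] at h6
    simp only [Complex.ofReal_zero, mul_zero, Complex.exp_zero, one_smul, hU.map_zero, zero_sub,
      neg_smul, neg_inj] at h6
    exact h6.symm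
  · intro hf
    have h1 := hU.map_laplaceResolvent hz (h - z • f)
    rw [← hf] at h1
    set σ := Real.sign z.im with hσdef
    set w := Complex.I * (σ : ℂ) * z with hwdef
    have h2 : HasDerivAt (fun t : ℝ => U (σ * t) f) (-(Complex.I * σ) • h) 0 := by
      simp only [h1]
      have h3 := ((hU.continuous_laplace w σ (h - z • f)).integral_hasStrictDerivAt 0
        0).hasDerivAt
      have h4 := (hexp (-w) 0).smul ((h3.const_smul (Complex.I * (σ : ℂ))).const_sub f)
      refine h4.congr_deriv ?_
      simp only [mul_zero, hU.map_zero, hwdef, Complex.ofReal_zero, Complex.exp_zero, one_smul,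
        Pi.smul_apply, intervalIntegral.integral_same, smul_zero, sub_zero, mul_one]
      module
    have h5 : HasDerivAt (fun t : ℝ => σ * t) σ 0 := by
      simpa using (hasDerivAt_id (0 : ℝ)).const_mul σ
    have h6 := HasDerivAt.scomp (g₁ := fun t : ℝ => U (σ * t) f) (h := fun t : ℝ => σ * t) 0
      (by simpa using h2) h5
    convert h6 using 1
    · ext1 t
      simp [← mul_assoc, hσ]
    · rw [← Complex.coe_smul, ← neg_smul, smul_smul, show (σ : ℂ) * -(Complex.I * σ) =
        -Complex.I * (σ * σ) by ring, hσc, mul_one]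

end IsUnitaryFlow

end UnitaryFlow

/-! ### Testing L² functions; the free flow and its generator -/

/-- The bilinear pairing `f ↦ ∫ f χ` of `L²(ℝ²)` with a square integrable function. -/
def pairing {χ : ℝ × ℝ → ℂ} (hχ : MemLp χ 2) : PhaseL2 →L[ℂ] ℂ :=
  innerSL ℂ (hχ.star.toLp (star χ))

theorem pairing_apply {χ : ℝ × ℝ → ℂ} (hχ : MemLp χ 2) (f : PhaseL2) :
    pairing hχ f = ∫ x, f x * χ x := by
  rw [pairing, innerSL_apply_apply, L2.inner_def]
  refine integral_congr_ae ?_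
  filter_upwards [hχ.star.coeFn_toLp] with x hx
  rw [hx]
  simp

theorem eq_zero_of_forall_integral_test_eq_zero {f : PhaseL2}
    (h : ∀ η : ℝ × ℝ → ℂ, ContDiff ℝ ∞ η → HasCompactSupport η → ∫ x, f x * η x = 0) :
    f = 0 := by
  rw [Lp.eq_zero_iff_ae_eq_zero]
  refine ae_eq_zero_of_integral_contDiff_smul_eq_zero
    ((Lp.memLp f).locallyIntegrable (by norm_num)) ?_
  intro g hg hs
  rw [← h (fun x => (g x : ℂ)) (Complex.ofRealCLM.contDiff.comp hg)
    (hs.comp_left (g := fun r : ℝ => (r : ℂ)) (by simp))]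
  refine integral_congr_ae (ae_of_all _ fun x => ?_)
  simp [mul_comm]

/-- The phase-space map `(q, p) ↦ (q - p t / m, p)`. -/
def shear (m t : ℝ) : C(ℝ × ℝ, ℝ × ℝ) where
  toFun x := (x.1 - x.2 * t / m, x.2)

theorem shear_apply (m t : ℝ) (x : ℝ × ℝ) : shear m t x = (x.1 - x.2 * t / m, x.2) := rfl

theorem shear_zero (m : ℝ) (x : ℝ × ℝ) : shear m 0 x = x := by simp [shear_apply]

theorem shear_shear (m s t : ℝ) (x : ℝ × ℝ) : shear m s (shear m t x) = shear m (s + t) x := by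
  simp only [shear_apply, Prod.mk.injEq, and_true]
  ring

theorem contDiff_shear (m t : ℝ) : ContDiff ℝ ∞ (shear m t) := by
  change ContDiff ℝ ∞ fun x : ℝ × ℝ => (x.1 - x.2 * t / m, x.2)
  fun_prop

theorem measurePreserving_shear (m t : ℝ) : MeasurePreserving (shear m t) := by
  -- With the coordinates swapped, the shear is a skew product over p whose fibre maps are
  -- translations.
  have h1 : MeasurePreserving (fun x : ℝ × ℝ => (x.1, x.2 - x.1 * t / m))
      (volume.prod volume) (volume.prod volume) :=
    (MeasurePreserving.id volume).skew_product (g := fun p q => q - p * t / m) (by fun_prop)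
      (ae_of_all _ fun p => (measurePreserving_sub_right volume (p * t / m)).map_eq)
  exact (Measure.measurePreserving_swap.comp h1).comp Measure.measurePreserving_swap

/-- The homeomorphism `shear m t`. -/
def shearHomeomorph (m t : ℝ) : ℝ × ℝ ≃ₜ ℝ × ℝ where
  toFun := shear m t
  invFun := shear m (-t)
  left_inv x := by rw [shear_shear, neg_add_cancel, shear_zero]
  right_inv x := by rw [shear_shear, add_neg_cancel, shear_zero]
  continuous_toFun := (shear m t).continuous
  continuous_invFun := (shear m (-t)).continuous

theorem hasCompactSupport_comp_shear {η : ℝ × ℝ → ℂ} (hs : HasCompactSupport η) (m t : ℝ) :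
    HasCompactSupport fun x => η (shear m t x) :=
  hs.comp_homeomorph (shearHomeomorph m t)

theorem integral_comp_shear (m t : ℝ) (g : ℝ × ℝ → ℂ) : ∫ x, g (shear m t x) = ∫ x, g x :=
  (measurePreserving_shear m t).integral_comp (shearHomeomorph m t).measurableEmbedding g

/-- The free translation as a linear isometry. -/
def freeIsometry (m t : ℝ) : PhaseL2 →ₗᵢ[ℂ] PhaseL2 :=
  Lp.compMeasurePreservingₗᵢ ℂ (shear m t) (measurePreserving_shear m t)

theorem freeIsometry_ae (m t : ℝ) (f : PhaseL2) :
    freeIsometry m t f =ᵐ[volume] freeFlow m t f :=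
  Lp.coeFn_compMeasurePreserving f (measurePreserving_shear m t)

theorem freeIsometry_comp (m s t : ℝ) (f : PhaseL2) :
    freeIsometry m s (freeIsometry m t f) = freeIsometry m (s + t) f := by
  refine Lp.ext ?_
  filter_upwards [freeIsometry_ae m s (freeIsometry m t f), freeIsometry_ae m (s + t) f,
    (measurePreserving_shear m s).quasiMeasurePreserving.ae (freeIsometry_ae m t f)] with x h1 h2 h3
  rw [h1, h2]
  refine h3.trans ?_
  change f (shear m t (shear m s x)) = f (shear m (s + t) x)
  rw [shear_shear, add_comm]

theorem freeIsometry_zero (m : ℝ) (f : PhaseL2) : freeIsometry m 0 f = f := by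
  refine Lp.ext ?_
  filter_upwards [freeIsometry_ae m 0 f] with x hx
  simp [hx, freeFlow]

/-- The free group `f ↦ f (q - p t / m, p)`. -/
def freeGroup (m t : ℝ) : PhaseL2 ≃ₗᵢ[ℂ] PhaseL2 where
  toLinearEquiv := LinearEquiv.ofLinearMap (freeIsometry m t).toLinearMap
    (freeIsometry m (-t)).toLinearMap
    (LinearMap.ext fun f => by simp [freeIsometry_comp, freeIsometry_zero])
    (LinearMap.ext fun f => by simp [freeIsometry_comp, freeIsometry_zero])
  norm_map' f := (freeIsometry m t).norm_map f

theorem freeGroup_ae (m t : ℝ) (f : PhaseL2) : freeGroup m t f =ᵐ[volume] freeFlow m t f :=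
  freeIsometry_ae m t f

theorem isUnitaryFlow_freeGroup (m : ℝ) : IsUnitaryFlow (freeGroup m) where
  map_zero f := freeIsometry_zero m f
  map_add s t f := (freeIsometry_comp m s t f).symm
  continuous f := by
    refine Continuous.compMeasurePreservingLp (f := fun _ => f) (g := fun t => shear m t)
      continuous_const ?_ (fun t => measurePreserving_shear m t) (by simp)
    refine ContinuousMap.continuous_of_continuous_uncurry _ ?_
    change Continuous fun y : ℝ × (ℝ × ℝ) => (y.2.1 - y.2.2 * y.1 / m, y.2.2)
    fun_prop

theorem integral_freeGroup_mul (m t : ℝ) (f : PhaseL2) (η : ℝ × ℝ → ℂ) :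
    ∫ x, freeGroup m t f x * η x = ∫ x, f x * η (shear m (-t) x) := by
  rw [← integral_comp_shear m t (fun x => f x * η (shear m (-t) x))]
  refine integral_congr_ae ?_
  filter_upwards [freeGroup_ae m t f] with x hx
  rw [hx, shear_shear, neg_add_cancel, shear_zero]
  rfl

theorem hasDerivAt_comp_shear {η : ℝ × ℝ → ℂ} (hη : ContDiff ℝ ∞ η) (m t : ℝ) (x : ℝ × ℝ) :
    HasDerivAt (fun t => η (shear m (-t) x))
      (((x.2 / m : ℝ) : ℂ) * fderiv ℝ η (shear m (-t) x) (1, 0)) t := by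
  have h1 : HasDerivAt (fun t => shear m (-t) x) (x.2 / m, 0) t := by
    have h2 : HasDerivAt (fun t : ℝ => x.1 + x.2 / m * t) (x.2 / m) t := by
      simpa using ((hasDerivAt_id t).const_mul (x.2 / m)).const_add x.1
    refine ((h2.prodMk (hasDerivAt_const t x.2)).congr_of_eventuallyEq
      (Eventually.of_forall fun s => ?_))
    simp only [shear_apply, Prod.mk.injEq, and_true]
    ring
  have h3 := ((hη.differentiable (by simp)) (shear m (-t) x)).hasFDerivAt.comp_hasDerivAt t h1
  refine h3.congr_deriv ?_
  have : ((x.2 / m, 0) : ℝ × ℝ) = (x.2 / m) • (1, 0) := by simp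
  rw [this, map_smul]
  simp

/-- With the flow moved onto the test function, one may differentiate under the integral although f
need not be differentiable. -/
theorem hasDerivAt_integral_mul_comp_shear (m : ℝ) (f : PhaseL2) {η : ℝ × ℝ → ℂ}
    (hη : ContDiff ℝ ∞ η) (hs : HasCompactSupport η) :
    HasDerivAt (fun t => ∫ x, f x * η (shear m (-t) x))
      (∫ x, f x * (((x.2 / m : ℝ) : ℂ) * fderiv ℝ η x (1, 0))) 0 := by
  have hc : Continuous fun x => fderiv ℝ η x (1, 0) :=
    (hη.continuous_fderiv (by simp)).clm_apply continuous_const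
  obtain ⟨C, hC⟩ := (hs.fderiv_apply ℝ (1, 0)).exists_bound_of_continuous hc
  -- K is the region swept by the support of ∂_q η for |t| ≤ 1; it makes the dominating function
  -- integrable despite the unbounded factor p.
  obtain ⟨K, hK, hKs⟩ : ∃ K : Set (ℝ × ℝ), IsCompact K ∧ ∀ t ∈ Set.Icc (-1 : ℝ) 1, ∀ x,
      x ∉ K → fderiv ℝ η (shear m (-t) x) (1, 0) = 0 := by
    refine ⟨(fun y : ℝ × (ℝ × ℝ) => shear m y.1 y.2) '' (Set.Icc (-1 : ℝ) 1 ×ˢ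
      tsupport fun x => fderiv ℝ η x (1, 0)),
      (isCompact_Icc.prod (hs.fderiv_apply ℝ (1, 0))).image ?_, ?_⟩
    · change Continuous fun y : ℝ × (ℝ × ℝ) => (y.2.1 - y.2.2 * y.1 / m, y.2.2)
      fun_prop
    · intro t ht x hx
      by_contra h
      refine hx ⟨(t, shear m (-t) x), ⟨ht, subset_tsupport _ h⟩, ?_⟩
      simp [shear_shear, shear_zero]
  have hbound : Integrable (fun x => K.indicator (fun x => ‖f x‖ * (|x.2 / m| * C)) x) := by
    rw [integrable_indicator_iff hK.measurableSet]
    have h1 : IntegrableOn (fun x => ‖f x‖) K :=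
      (((Lp.memLp f).locallyIntegrable (by norm_num)).integrableOn_isCompact hK).norm
    exact h1.mul_continuousOn (by fun_prop) hK
  have hFm : ∀ t : ℝ, AEStronglyMeasurable (fun x => f x * η (shear m (-t) x)) := fun t =>
    (Lp.aestronglyMeasurable f).mul
      (hη.continuous.comp (shear m (-t)).continuous).aestronglyMeasurable
  have hmem : Set.Ioo (-1 : ℝ) 1 ∈ 𝓝 (0 : ℝ) := Ioo_mem_nhds (by norm_num) (by norm_num)
  have := (hasDerivAt_integral_of_dominated_loc_of_deriv_le (μ := volume) hmem
    (F := fun t x => f x * η (shear m (-t) x))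
    (F' := fun t x => f x * (((x.2 / m : ℝ) : ℂ) * fderiv ℝ η (shear m (-t) x) (1, 0)))
    (bound := fun x => K.indicator (fun x => ‖f x‖ * (|x.2 / m| * C)) x)
    (Eventually.of_forall hFm) ?_ ?_ ?_ hbound ?_).2
  · simpa [shear_zero] using this
  · exact integrable_L2_mul f (hη.continuous.comp (shear m _).continuous)
      (hasCompactSupport_comp_shear hs m _)
  · refine (Lp.aestronglyMeasurable f).mul (Continuous.aestronglyMeasurable ?_)
    have := hc.comp (shear m (-0)).continuous
    fun_prop
  · refine ae_of_all _ fun x t ht => ?_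
    by_cases hx : x ∈ K
    · rw [Set.indicator_of_mem hx, norm_mul, norm_mul, Complex.norm_real, Real.norm_eq_abs]
      gcongr
      exact hC _
    · rw [hKs t (Set.Ioo_subset_Icc_self ht) x hx, Set.indicator_of_notMem hx]
      simp
  · exact ae_of_all _ fun x t _ => (hasDerivAt_comp_shear hη m t x).const_mul _

/-- The weak equation tested with every sheared η gives the derivative of the pairing at every time,
and `hasDerivAt_of_weak` makes it strong. Conversely, pairing the strong derivative with η gives the
weak equation. -/
theorem isUnitaryGroup_freeGroup (m : ℝ) : IsUnitaryGroup (L0 m) (freeGroup m) := by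
  have hU := isUnitaryFlow_freeGroup m
  refine ⟨hU.map_zero, hU.map_add, hU.continuous, fun f h => ?_⟩
  rw [L0_graph, tendsto_slope_iff_hasDerivAt hU.map_zero]
  constructor
  · intro hw
    let ι := {η : ℝ × ℝ → ℂ // ContDiff ℝ ∞ η ∧ HasCompactSupport η}
    have hι : ∀ η : ι, MemLp η.1 2 := fun η =>
      η.2.1.continuous.memLp_of_hasCompactSupport η.2.2
    refine hU.hasDerivAt_of_weak (fun η : ι => pairing (hι η)) ?_ ?_
    · intro f hf
      refine eq_zero_of_forall_integral_test_eq_zero fun η hη hs => ?_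
      rw [← hf ⟨η, hη, hs⟩, pairing_apply]
    · rintro ⟨η, hη, hs⟩ t
      simp only [pairing_apply, integral_freeGroup_mul]
      have hη' : ContDiff ℝ ∞ fun x => η (shear m (-t) x) := hη.comp (contDiff_shear m (-t))
      have hs' := hasCompactSupport_comp_shear hs m (-t)
      have h1 := hasDerivAt_integral_mul_comp_shear m f hη' hs'
      simp only [shear_shear] at h1
      have h2 := HasDerivAt.comp_sub_const (f := fun s => ∫ x, f x * η (shear m (-t + -s) x)) t t
        (by rw [sub_self]; exact h1)
      have h3 := hw _ hη' hs'
      have h4 : (fun s => ∫ x, f x * η (shear m (-s) x)) =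
          fun s => ∫ x, f x * η (shear m (-t + -(s - t)) x) := by
        ext s
        congr! 4
        ring_nf
      rw [h4]
      refine h2.congr_deriv ?_
      have h5 : ∫ x, (-Complex.I • h : PhaseL2) x * η (shear m (-t) x) =
          -Complex.I * ∫ x, h x * η (shear m (-t) x) := by
        rw [← integral_const_mul]
        refine integral_congr_ae ?_
        filter_upwards [Lp.coeFn_smul (-Complex.I) h] with x hx
        rw [hx, Pi.smul_apply, smul_eq_mul, mul_assoc]
      rw [h5, h3, ← integral_const_mul]
      refine integral_congr_ae (ae_of_all _ fun x => ?_)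
      simp only
      linear_combination ((f x : ℂ) * ((x.2 / m : ℝ) : ℂ) *
        fderiv ℝ (fun x => η (shear m (-t) x)) x (1, 0)) * Complex.I_mul_I
  · intro hd η hη hs
    have h1 := hasDerivAt_integral_mul_comp_shear m f hη hs
    have hχ : MemLp η 2 := hη.continuous.memLp_of_hasCompactSupport hs
    have h2 := ((pairing hχ).restrictScalars ℝ).hasFDerivAt.comp_hasDerivAt 0 hd
    have h3 : (⇑((pairing hχ).restrictScalars ℝ) ∘ fun t => freeGroup m t f) =
        fun t => ∫ x, f x * η (shear m (-t) x) := by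
      ext t
      simp only [Function.comp_apply, ContinuousLinearMap.coe_restrictScalars', pairing_apply,
        integral_freeGroup_mul]
    rw [h3] at h2
    have h4 := h2.unique h1
    rw [ContinuousLinearMap.coe_restrictScalars', map_smul, pairing_apply, smul_eq_mul] at h4
    have h5 : ∫ x, f x * (Complex.I * ((x.2 / m : ℝ) : ℂ) * fderiv ℝ η x (1, 0)) =
        Complex.I * ∫ x, f x * (((x.2 / m : ℝ) : ℂ) * fderiv ℝ η x (1, 0)) := by
      rw [← integral_const_mul]
      refine integral_congr_ae (ae_of_all _ fun x => ?_)
      simp only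
      ring
    simp only
    rw [h5, ← h4]
    linear_combination (∫ x, h x * η x) * Complex.I_mul_I

/-! ### Unitaries acting by an even multiplier on the odd part -/

theorem PhaseL2.norm_sq_eq_integral (g : PhaseL2) : ‖g‖ ^ 2 = ∫ x, ‖g x‖ ^ 2 := by
  have h1 : inner ℂ g g = ((‖g‖ : ℂ)) ^ 2 := inner_self_eq_norm_sq_to_K g
  rw [L2.inner_def] at h1
  apply Complex.ofReal_injective
  rw [Complex.ofReal_pow, ← h1, ← integral_complex_ofReal]
  refine integral_congr_ae (ae_of_all _ fun x => ?_)
  simp only [inner_self_eq_norm_sq_to_K]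
  norm_cast

/-- The function `f - w f_odd`. -/
def scatter (w f : ℝ × ℝ → ℂ) (x : ℝ × ℝ) : ℂ := f x - w x * fOdd f x

/-- A measurable even multiplier `w` with `|1 - 2 w| = 1`: the conditions under which
`f ↦ f - w f_odd` is unitary. -/
structure IsScatterer (w : ℝ × ℝ → ℂ) : Prop where
  measurable : Measurable w
  even : ∀ x, w (-x) = w x
  add_conj : ∀ x, w x + star (w x) = 2 * (w x * star (w x))

theorem fOdd_apply (f : ℝ × ℝ → ℂ) (x : ℝ × ℝ) : fOdd f x = f x - f (-x) := rfl

theorem fOdd_ae_congr {f g : ℝ × ℝ → ℂ} (h : f =ᵐ[volume] g) : fOdd f =ᵐ[volume] fOdd g := by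
  filter_upwards [h, (Measure.measurePreserving_neg volume).quasiMeasurePreserving.ae h]
    with x h1 h2
  rw [fOdd_apply, fOdd_apply, h1, h2]

theorem scatter_ae_congr (w : ℝ × ℝ → ℂ) {f g : ℝ × ℝ → ℂ} (h : f =ᵐ[volume] g) :
    scatter w f =ᵐ[volume] scatter w g := by
  filter_upwards [h, fOdd_ae_congr h] with x h1 h2
  rw [scatter, scatter, h1, h2]

namespace IsScatterer

variable {w : ℝ × ℝ → ℂ}

theorem star (hw : IsScatterer w) : IsScatterer (fun x => star (w x)) where
  measurable := continuous_star.measurable.comp hw.measurable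
  even x := by rw [hw.even]
  add_conj x := by rw [star_star, add_comm, hw.add_conj, mul_comm (w x)]

theorem norm_le_one (hw : IsScatterer w) (x : ℝ × ℝ) : ‖w x‖ ≤ 1 := by
  have h := congrArg norm (hw.add_conj x)
  have h1 := norm_add_le (w x) (Star.star (w x))
  rw [h] at h1
  simp only [norm_mul, norm_star, Complex.norm_ofNat] at h1
  by_contra! h2
  nlinarith

/-- On the pair (f(x), f(-x)) the map keeps the sum and multiplies the difference by 1 - 2w(x), of
modulus one, so it is unitary on ℂ². -/
theorem norm_sq_add_norm_sq (hw : IsScatterer w) (f : ℝ × ℝ → ℂ) (x : ℝ × ℝ) :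
    ‖scatter w f x‖ ^ 2 + ‖scatter w f (-x)‖ ^ 2 = ‖f x‖ ^ 2 + ‖f (-x)‖ ^ 2 := by
  have h := hw.add_conj x
  have key : ∀ a : ℂ, ((‖a‖ ^ 2 : ℝ) : ℂ) = a * Star.star a := fun a => by
    rw [Complex.star_def, Complex.mul_conj, Complex.normSq_eq_norm_sq]
  apply Complex.ofReal_injective
  rw [Complex.ofReal_add, Complex.ofReal_add, key, key, key, key]
  simp only [scatter, fOdd_apply, neg_neg, hw.even, star_sub, star_mul]
  linear_combination (-(f x - f (-x)) * (Star.star (f x) - Star.star (f (-x)))) * h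

theorem scatter_star_scatter (hw : IsScatterer w) (f : ℝ × ℝ → ℂ) (x : ℝ × ℝ) :
    scatter (fun x => Star.star (w x)) (scatter w f) x = f x := by
  have h := hw.add_conj x
  simp only [scatter, fOdd_apply, neg_neg, hw.even]
  linear_combination -(f x - f (-x)) * h

theorem memLp_scatter (hw : IsScatterer w) {f : ℝ × ℝ → ℂ} (hf : MemLp f 2) :
    MemLp (scatter w f) 2 := by
  have h1 : MemLp (fOdd f) 2 :=
    hf.sub (hf.comp_measurePreserving (Measure.measurePreserving_neg volume))
  have h2 : MemLp (fun x => w x * fOdd f x) 2 :=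
    h1.of_le (hw.measurable.aestronglyMeasurable.mul h1.1) (ae_of_all _ fun x => by
      rw [norm_mul]
      exact mul_le_of_le_one_left (norm_nonneg _) (hw.norm_le_one x))
  exact hf.sub h2

theorem integral_norm_sq_scatter (hw : IsScatterer w) {f : ℝ × ℝ → ℂ} (hf : MemLp f 2) :
    ∫ x, ‖scatter w f x‖ ^ 2 = ∫ x, ‖f x‖ ^ 2 := by
  have key : ∀ g : ℝ × ℝ → ℂ, MemLp g 2 →
      ∫ x, (‖g x‖ ^ 2 + ‖g (-x)‖ ^ 2) = 2 * ∫ x, ‖g x‖ ^ 2 := by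
    intro g hg
    have h1 : Integrable fun x => ‖g x‖ ^ 2 := hg.integrable_norm_pow (by norm_num)
    rw [integral_add h1 h1.comp_neg, integral_neg_eq_self (fun x => ‖g x‖ ^ 2)]
    ring
  have h1 := key _ (hw.memLp_scatter hf)
  simp only [hw.norm_sq_add_norm_sq] at h1
  rw [key f hf] at h1
  linarith

/-- The linear map `f ↦ f - w f_odd` on `L²(ℝ²)`. -/
def linearMap (hw : IsScatterer w) : PhaseL2 →ₗ[ℂ] PhaseL2 where
  toFun f := (hw.memLp_scatter (Lp.memLp f)).toLp _
  map_add' f g := by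
    refine Lp.ext ?_
    filter_upwards [(hw.memLp_scatter (Lp.memLp (f + g))).coeFn_toLp,
      (hw.memLp_scatter (Lp.memLp f)).coeFn_toLp, (hw.memLp_scatter (Lp.memLp g)).coeFn_toLp,
      Lp.coeFn_add ((hw.memLp_scatter (Lp.memLp f)).toLp _)
        ((hw.memLp_scatter (Lp.memLp g)).toLp _),
      scatter_ae_congr w (Lp.coeFn_add f g)] with x h1 h2 h3 h4 h5
    rw [h1, h5, h4, Pi.add_apply, h2, h3]
    simp only [scatter, fOdd_apply, Pi.add_apply]
    ring
  map_smul' c f := by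
    refine Lp.ext ?_
    filter_upwards [(hw.memLp_scatter (Lp.memLp (c • f))).coeFn_toLp,
      (hw.memLp_scatter (Lp.memLp f)).coeFn_toLp,
      Lp.coeFn_smul c ((hw.memLp_scatter (Lp.memLp f)).toLp _),
      scatter_ae_congr w (Lp.coeFn_smul c f)] with x h1 h2 h4 h5
    rw [h1, h5, RingHom.id_apply, h4, Pi.smul_apply, h2]
    simp only [scatter, fOdd_apply, Pi.smul_apply, smul_eq_mul]
    ring

theorem linearMap_ae (hw : IsScatterer w) (f : PhaseL2) :
    hw.linearMap f =ᵐ[volume] scatter w f :=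
  (hw.memLp_scatter (Lp.memLp f)).coeFn_toLp

theorem linearMap_star_linearMap (hw : IsScatterer w) (f : PhaseL2) :
    hw.star.linearMap (hw.linearMap f) = f := by
  refine Lp.ext ?_
  filter_upwards [hw.star.linearMap_ae (hw.linearMap f),
    scatter_ae_congr (fun x => Star.star (w x)) (hw.linearMap_ae f)] with x h1 h2
  rw [h1, h2, hw.scatter_star_scatter]

theorem linearMap_linearMap_star (hw : IsScatterer w) (f : PhaseL2) :
    hw.linearMap (hw.star.linearMap f) = f := by
  have := hw.star.linearMap_star_linearMap f
  simpa only [star_star] using this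

theorem norm_linearMap (hw : IsScatterer w) (f : PhaseL2) : ‖hw.linearMap f‖ = ‖f‖ := by
  have h2 : ‖hw.linearMap f‖ ^ 2 = ‖f‖ ^ 2 := by
    rw [PhaseL2.norm_sq_eq_integral, PhaseL2.norm_sq_eq_integral,
      ← hw.integral_norm_sq_scatter (Lp.memLp f)]
    refine integral_congr_ae ?_
    filter_upwards [hw.linearMap_ae f] with x hx
    rw [hx]
  exact (pow_left_inj₀ (norm_nonneg _) (norm_nonneg _) two_ne_zero).1 h2

/-- The unitary map `f ↦ f - w f_odd`. -/
def isometryEquiv (hw : IsScatterer w) : PhaseL2 ≃ₗᵢ[ℂ] PhaseL2 where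
  toLinearEquiv := LinearEquiv.ofLinearMap hw.linearMap hw.star.linearMap
    (LinearMap.ext hw.linearMap_linearMap_star) (LinearMap.ext hw.linearMap_star_linearMap)
  norm_map' := hw.norm_linearMap

theorem isometryEquiv_ae (hw : IsScatterer w) (f : PhaseL2) :
    hw.isometryEquiv f =ᵐ[volume] scatter w f := hw.linearMap_ae f

theorem isometryEquiv_symm_ae (hw : IsScatterer w) (f : PhaseL2) :
    hw.isometryEquiv.symm f =ᵐ[volume] scatter (fun x => Star.star (w x)) f :=
  hw.star.linearMap_ae f

end IsScatterer

theorem IsUnitaryFlow.conj {H : Type*} [NormedAddCommGroup H] [InnerProductSpace ℂ H]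
    {U : ℝ → H ≃ₗᵢ[ℂ] H} (hU : IsUnitaryFlow U) (W : H ≃ₗᵢ[ℂ] H) :
    IsUnitaryFlow fun t => (W.trans (U t)).trans W.symm where
  map_zero f := by simp [hU.map_zero]
  map_add s t f := by simp [hU.map_add]
  continuous f := W.symm.continuous.comp (hU.continuous (W f))

/-! ### The wave operator and the explicit form of the perturbed group -/

/-- The dimensionless ratio `2 |p| / (m B(p))`. -/
def kappa (m : ℝ) (b : OnePoint ℝ) (p : ℝ) : ℝ := 2 * |p| / m * recip (Bfun b p)

theorem measurable_kappa (m : ℝ) (b : OnePoint ℝ) : Measurable (kappa m b) := by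
  unfold kappa
  have h : Measurable fun p => recip (Bfun b p) := by
    induction b using OnePoint.rec with
    | infty => exact measurable_const
    | coe r =>
      change Measurable fun p : ℝ => (r * p ^ 2)⁻¹
      fun_prop
  fun_prop

theorem kappa_neg (m : ℝ) (b : OnePoint ℝ) (p : ℝ) : kappa m b (-p) = kappa m b p := by
  have h : Bfun b (-p) = Bfun b p := by simp [Bfun]
  rw [kappa, kappa, h, abs_neg]

theorem one_add_I_mul_ne_zero (k : ℝ) : (1 : ℂ) + Complex.I * k ≠ 0 := by
  intro h
  simpa using congrArg Complex.re h

theorem one_sub_I_mul_ne_zero (k : ℝ) : (1 : ℂ) - Complex.I * k ≠ 0 := by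
  intro h
  simpa using congrArg Complex.re h

/-- The multiplier of the wave operator intertwining the free and the perturbed group. -/
def waveMult (m : ℝ) (b : OnePoint ℝ) (x : ℝ × ℝ) : ℂ :=
  (heaviside (x.1 * x.2) : ℂ) / (1 - Complex.I * kappa m b x.2)

theorem measurable_heaviside : Measurable heaviside :=
  Measurable.ite measurableSet_Ioi measurable_const measurable_const

theorem star_waveMult (m : ℝ) (b : OnePoint ℝ) (x : ℝ × ℝ) :
    star (waveMult m b x) = (heaviside (x.1 * x.2) : ℂ) / (1 + Complex.I * kappa m b x.2) := by
  simp [waveMult]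

theorem isScatterer_waveMult (m : ℝ) (b : OnePoint ℝ) : IsScatterer (waveMult m b) where
  measurable := by
    have h1 := measurable_kappa m b
    have h2 := measurable_heaviside
    unfold waveMult
    fun_prop
  even x := by simp [waveMult, kappa_neg]
  add_conj x := by
    rw [star_waveMult, waveMult]
    have h1 := one_add_I_mul_ne_zero (kappa m b x.2)
    have h2 := one_sub_I_mul_ne_zero (kappa m b x.2)
    unfold heaviside
    split_ifs
    · field_simp
      push_cast
      ring
    · simp

/-- The coefficient of the scattered part at time `t`. -/
def scatterCoeff (m : ℝ) (b : OnePoint ℝ) (t : ℝ) (x : ℝ × ℝ) : ℂ :=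
  ((heaviside (t * x.1 * x.2) * heaviside (|x.2 * t| / m - |x.1|) : ℝ) : ℂ) /
    (1 + (Real.sign t : ℂ) * (2 * Complex.I * |x.2| / m * (recip (Bfun b x.2) : ℂ)))

theorem scatterCoeff_eq (m : ℝ) (b : OnePoint ℝ) (t : ℝ) (x : ℝ × ℝ) :
    scatterCoeff m b t x = ((heaviside (t * x.1 * x.2) * heaviside (|x.2 * t| / m - |x.1|) : ℝ) : ℂ)
      / (1 + (Real.sign t : ℂ) * (Complex.I * kappa m b x.2)) := by
  rw [scatterCoeff, kappa]
  push_cast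
  ring_nf

/-- The left side is (1 - c)/2 for c = (1 - 2w(y))(1 - 2 conj w(x)), with y = `shear m t x`. It
vanishes when x and y are both incoming or both outgoing, and otherwise equals the one surviving
multiplier; its conjugation matches the sign of t. -/
theorem waveMult_combination {m : ℝ} (hm : 0 < m) (b : OnePoint ℝ) (t : ℝ) {x : ℝ × ℝ}
    (hp : x.2 ≠ 0) (hq : x.1 ≠ 0) (hy : (shear m t x).1 ≠ 0) :
    waveMult m b (shear m t x) + star (waveMult m b x) -
      2 * (waveMult m b (shear m t x) * star (waveMult m b x)) = scatterCoeff m b t x := by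
  obtain ⟨q, p⟩ := x
  simp only [shear_apply] at hp hq hy
  have h1 := one_add_I_mul_ne_zero (kappa m b p)
  have h2 := one_sub_I_mul_ne_zero (kappa m b p)
  rw [star_waveMult, waveMult, scatterCoeff_eq]
  simp only [shear_apply]
  set k := kappa m b p
  have hq1 : 0 < |q| := abs_pos.2 hq
  have hp1 : 0 < |p| := abs_pos.2 hp
  have e1 : (q - p * t / m) * p = q * p - p ^ 2 * t / m := by ring
  have e2 : |p * t| / m - |q| = (p ^ 2 * |t| / m - |q * p|) / |p| := by
    rw [abs_mul, abs_mul, ← sq_abs p]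
    field_simp
  have e3 : heaviside (|p * t| / m - |q|) = heaviside (p ^ 2 * |t| / m - |q * p|) := by
    rw [e2]
    unfold heaviside
    simp only [div_pos_iff_of_pos_right hp1]
  have hY : q * p - p ^ 2 * t / m ≠ 0 := by rw [← e1]; exact mul_ne_zero hy hp
  have hX : q * p ≠ 0 := mul_ne_zero hq hp
  have hP : 0 < p ^ 2 / m := by positivity
  rw [e3, e1, mul_assoc t]
  have e4 : ∀ s, p ^ 2 * s / m = p ^ 2 / m * s := fun s => by ring
  rw [e4] at hY
  rw [e4, e4]
  -- Only X = qp and P = p²/m matter: the earlier point has product X - Pt, and the cut-off has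
  -- become θ(P|t| - |X|).
  generalize q * p = X at *
  generalize p ^ 2 / m = P at *
  have hθ1 : ∀ {a : ℝ}, 0 < a → heaviside a = 1 := fun h => if_pos h
  have hθ0 : ∀ {a : ℝ}, a ≤ 0 → heaviside a = 0 := fun h => if_neg (not_lt.2 h)
  rcases lt_or_gt_of_ne hX with hX | hX <;> rcases lt_or_gt_of_ne hY with hY | hY
  · have h3 : heaviside (t * X) * heaviside (P * |t| - |X|) = 0 := by
      rcases le_or_gt 0 t with ht | ht
      · rw [hθ0 (mul_nonpos_of_nonneg_of_nonpos ht hX.le), zero_mul]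
      · rw [hθ0 (a := P * |t| - |X|), mul_zero]
        rw [abs_of_neg ht, abs_of_neg hX]
        linarith
    rw [h3, hθ0 hX.le, hθ0 hY.le]
    simp
  · have ht : t < 0 := by
      by_contra! ht
      have := mul_nonneg hP.le ht
      linarith
    rw [hθ0 hX.le, hθ1 hY, hθ1 (mul_pos_of_neg_of_neg ht hX), hθ1 (a := P * |t| - |X|),
      Real.sign_of_neg ht]
    · simp [sub_eq_add_neg]
    · rw [abs_of_neg ht, abs_of_neg hX]
      linarith
  · have ht : 0 < t := by
      by_contra! ht
      have := mul_nonpos_of_nonneg_of_nonpos hP.le ht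
      linarith
    rw [hθ1 hX, hθ0 hY.le, hθ1 (mul_pos ht hX), hθ1 (a := P * |t| - |X|), Real.sign_of_pos ht]
    · push_cast
      field_simp
      ring
    · rw [abs_of_pos ht, abs_of_pos hX]
      linarith
  · have h3 : heaviside (t * X) * heaviside (P * |t| - |X|) = 0 := by
      rcases le_or_gt t 0 with ht | ht
      · rw [hθ0 (mul_nonpos_of_nonpos_of_nonneg ht hX.le), zero_mul]
      · rw [hθ0 (a := P * |t| - |X|), mul_zero]
        rw [abs_of_pos ht, abs_of_pos hX]
        linarith
    rw [h3, hθ1 hX, hθ1 hY]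
    push_cast
    field_simp
    ring

/-- The perturbed group, conjugate to the free one by the wave operator. -/
def perturbedGroup (m : ℝ) (b : OnePoint ℝ) (t : ℝ) : PhaseL2 ≃ₗᵢ[ℂ] PhaseL2 :=
  ((isScatterer_waveMult m b).isometryEquiv.trans (freeGroup m t)).trans
    (isScatterer_waveMult m b).isometryEquiv.symm

theorem isUnitaryFlow_perturbedGroup (m : ℝ) (b : OnePoint ℝ) :
    IsUnitaryFlow (perturbedGroup m b) :=
  (isUnitaryFlow_freeGroup m).conj _

theorem perturbedGroup_ae {m : ℝ} (hm : 0 < m) (b : OnePoint ℝ) (t : ℝ) (f : PhaseL2) :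
    perturbedGroup m b t f =ᵐ[volume]
      fun x => freeFlow m t f x - scatterCoeff m b t x * freeFlow m t (fOdd f) x := by
  have hw := isScatterer_waveMult m b
  have hs := (measurePreserving_shear m t).quasiMeasurePreserving
  have h0 := Measure.ae_ne volume (0 : ℝ)
  have hq : ∀ᵐ x : ℝ × ℝ, x.1 ≠ 0 := Measure.quasiMeasurePreserving_fst.ae h0
  have hp : ∀ᵐ x : ℝ × ℝ, x.2 ≠ 0 := Measure.quasiMeasurePreserving_snd.ae h0
  have h1 : freeGroup m t (hw.isometryEquiv f) =ᵐ[volume]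
      fun x => scatter (waveMult m b) f (shear m t x) :=
    (freeGroup_ae m t _).trans (hs.ae (hw.isometryEquiv_ae f))
  filter_upwards [hw.isometryEquiv_symm_ae (freeGroup m t (hw.isometryEquiv f)),
    scatter_ae_congr (fun x => star (waveMult m b x)) h1, hq, hp, hs.ae hq] with x h2 h3 h4 h5 h6
  refine (h2.trans h3).trans ?_
  rw [← waveMult_combination hm b t h5 h4 h6]
  -- The free flow commutes with the reflection, so the odd part is transported to an odd part.
  have e : shear m t (-x) = -shear m t x := by
    simp only [shear_apply, Prod.fst_neg, Prod.snd_neg, Prod.neg_mk, Prod.mk.injEq, and_true]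
    ring
  have e1 : freeFlow m t f x = f (shear m t x) := rfl
  have e2 : freeFlow m t (fOdd f) x = f (shear m t x) - f (-shear m t x) := rfl
  rw [e1, e2]
  simp only [scatter, fOdd_apply, e, neg_neg, hw.even]
  ring

/-! ### Pointwise evaluation of Laplace resolvents -/

/-- Needed for Fubini. On a set of finite measure |k| ≤ 1 + |k|² bounds the L¹ norm, uniformly in s
because the group is isometric; the exponential gives integrability in s. -/
theorem integrable_laplace_kernel {U : ℝ → PhaseL2 ≃ₗᵢ[ℂ] PhaseL2} {w : ℂ} (hw : w.re < 0)
    {σ : ℝ} {g : PhaseL2} {k : ℝ → ℝ × ℝ → ℂ} (hk : Measurable fun y : ℝ × (ℝ × ℝ) => k y.1 y.2)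
    (hUk : ∀ s, U (σ * s) g =ᵐ[volume] k s) {S : Set (ℝ × ℝ)} (hS : volume S < ⊤) :
    Integrable (fun y : ℝ × (ℝ × ℝ) => Complex.exp (w * y.1) * k y.1 y.2)
      ((volume.restrict (Set.Ioi 0)).prod (volume.restrict S)) := by
  have hm : Measurable fun y : ℝ × (ℝ × ℝ) => Complex.exp (w * y.1) * k y.1 y.2 := by fun_prop
  have : IsFiniteMeasure (volume.restrict S) := ⟨by simpa using hS⟩
  have hL : ∀ s, MemLp (k s) 2 := fun s => (Lp.memLp (U (σ * s) g)).ae_eq (hUk s)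
  have hkS : ∀ s, IntegrableOn (k s) S := fun s =>
    ((hL s).restrict S).integrable (by norm_num)
  have hk2 : ∀ s, Integrable (fun x => ‖k s x‖ ^ 2) := fun s =>
    (hL s).integrable_norm_pow (by norm_num)
  have hb : ∀ s, ∫ x in S, ‖k s x‖ ≤ volume.real S + ‖g‖ ^ 2 := by
    intro s
    calc ∫ x in S, ‖k s x‖ ≤ ∫ x in S, (1 + ‖k s x‖ ^ 2) := by
          refine integral_mono (hkS s).norm ((integrable_const _).add (hk2 s).restrict) fun x => ?_
          simp only
          nlinarith [sq_nonneg (‖k s x‖ - 1), sq_nonneg ‖k s x‖]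
      _ = volume.real S + ∫ x in S, ‖k s x‖ ^ 2 := by
          rw [integral_add (integrable_const _) (hk2 s).restrict]
          simp
      _ ≤ volume.real S + ∫ x, ‖k s x‖ ^ 2 := by
          exact add_le_add le_rfl
            (setIntegral_le_integral (hk2 s) (ae_of_all _ fun x => sq_nonneg _))
      _ = volume.real S + ‖g‖ ^ 2 := by
          rw [← (U (σ * s)).norm_map g, PhaseL2.norm_sq_eq_integral]
          congr 1
          refine integral_congr_ae ?_
          filter_upwards [hUk s] with x hx
          rw [hx]
  refine (integrable_prod_iff hm.aestronglyMeasurable).2 ⟨ae_of_all _ fun s =>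
    (hkS s).const_mul (Complex.exp (w * s)), ?_⟩
  refine Integrable.mono' (((integrableOn_exp_mul_complex_Ioi hw 0).norm).mul_const
    (volume.real S + ‖g‖ ^ 2)) hm.norm.stronglyMeasurable.integral_prod_right.aestronglyMeasurable
    (ae_of_all _ fun s => ?_)
  rw [Real.norm_of_nonneg (integral_nonneg fun x => norm_nonneg _)]
  simp only [norm_mul]
  rw [integral_const_mul]
  gcongr
  exact hb s

/-- The Laplace resolvent is computed pointwise almost everywhere. -/
theorem IsUnitaryFlow.laplaceResolvent_ae {U : ℝ → PhaseL2 ≃ₗᵢ[ℂ] PhaseL2}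
    (hU : IsUnitaryFlow U) {z : ℂ} (hz : z.im ≠ 0) (g : PhaseL2) {k : ℝ → ℝ × ℝ → ℂ}
    (hk : Measurable fun y : ℝ × (ℝ × ℝ) => k y.1 y.2)
    (hUk : ∀ s, U (Real.sign z.im * s) g =ᵐ[volume] k s) :
    (laplaceResolvent U z g : PhaseL2) =ᵐ[volume] fun x => Complex.I * (Real.sign z.im : ℂ) *
      ∫ s in Set.Ioi (0 : ℝ), Complex.exp (Complex.I * (Real.sign z.im : ℂ) * z * s) * k s x := by
  have hw := re_I_mul_sign_mul_neg hz
  have hInt := fun {S : Set (ℝ × ℝ)} (hS : volume S < ⊤) =>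
    integrable_laplace_kernel hw hk hUk hS
  refine ae_eq_of_forall_setIntegral_eq_of_sigmaFinite ?_ ?_ ?_
  · intro S _ hS
    have : IsFiniteMeasure (volume.restrict S) := ⟨by simpa using hS⟩
    exact ((Lp.memLp (laplaceResolvent U z g)).restrict S).integrable (by norm_num)
  · intro S _ hS
    exact (hInt hS).integral_prod_right.const_mul _
  · intro S hSm hS
    -- Integration over S is a continuous functional on L², so it passes through the vector-valued
    -- integral.
    have hχ : MemLp (S.indicator fun _ => (1 : ℂ)) 2 (volume : Measure (ℝ × ℝ)) :=
      memLp_indicator_const 2 hSm 1 (Or.inr hS.ne)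
    have hp : ∀ f : PhaseL2, pairing hχ f = ∫ x in S, f x := by
      intro f
      rw [pairing_apply, ← integral_indicator hSm]
      refine integral_congr_ae (ae_of_all _ fun x => ?_)
      by_cases hx : x ∈ S <;> simp [hx]
    rw [← hp, hU.apply_laplaceResolvent hz, integral_const_mul]
    congr 1
    rw [integral_integral_swap (f := fun x s =>
      Complex.exp (Complex.I * (Real.sign z.im : ℂ) * z * (s : ℝ)) * k s x) (hInt hS).swap]
    refine integral_congr_ae (ae_of_all _ fun s => ?_)
    simp only
    rw [hp, integral_const_mul]
    congr 1
    exact setIntegral_congr_ae₀ hSm.nullMeasurableSet ((hUk s).mono fun x hx _ => hx)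

/-- The free resolvent as a pointwise integral along the free trajectories. -/
def freeRes (m : ℝ) (z : ℂ) (g : ℝ × ℝ → ℂ) (x : ℝ × ℝ) : ℂ :=
  Complex.I * (Real.sign z.im : ℂ) * ∫ s in Set.Ioi (0 : ℝ),
    Complex.exp (Complex.I * (Real.sign z.im : ℂ) * z * s) * freeFlow m (Real.sign z.im * s) g x

theorem measurable_freeFlow (m σ : ℝ) {g : ℝ × ℝ → ℂ} (hg : Measurable g) :
    Measurable fun y : ℝ × (ℝ × ℝ) => freeFlow m (σ * y.1) g y.2 := by
  unfold freeFlow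
  fun_prop

theorem laplaceResolvent_freeGroup_ae (m : ℝ) {z : ℂ} (hz : z.im ≠ 0) (g : PhaseL2) :
    (laplaceResolvent (freeGroup m) z g : PhaseL2) =ᵐ[volume] freeRes m z g :=
  (isUnitaryFlow_freeGroup m).laplaceResolvent_ae hz g
    (measurable_freeFlow m _ (Lp.stronglyMeasurable g).measurable)
    (fun _ => freeGroup_ae m _ g)

theorem measurable_scatterCoeff (m : ℝ) (b : OnePoint ℝ) :
    Measurable fun y : ℝ × (ℝ × ℝ) => scatterCoeff m b y.1 y.2 := by
  simp only [scatterCoeff_eq]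
  have h1 := measurable_heaviside
  have h2 := measurable_kappa m b
  have h3 : Measurable Real.sign :=
    Measurable.ite measurableSet_Iio measurable_const
      (Measurable.ite measurableSet_Ioi measurable_const measurable_const)
  have h4 : Measurable fun x : ℝ => |x| := continuous_abs.measurable
  fun_prop

theorem laplaceResolvent_perturbedGroup_ae {m : ℝ} (hm : 0 < m) (b : OnePoint ℝ) {z : ℂ}
    (hz : z.im ≠ 0) (g : PhaseL2) :
    (laplaceResolvent (perturbedGroup m b) z g : PhaseL2) =ᵐ[volume] fun x =>
      Complex.I * (Real.sign z.im : ℂ) * ∫ s in Set.Ioi (0 : ℝ),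
        Complex.exp (Complex.I * (Real.sign z.im : ℂ) * z * s) *
          (freeFlow m (Real.sign z.im * s) g x -
            scatterCoeff m b (Real.sign z.im * s) x * freeFlow m (Real.sign z.im * s) (fOdd g) x) := by
  have hg := (Lp.stronglyMeasurable g).measurable
  have hgo : Measurable (fOdd g) := hg.sub (hg.comp measurable_neg)
  refine (isUnitaryFlow_perturbedGroup m b).laplaceResolvent_ae hz g
    (k := fun s x => freeFlow m (Real.sign z.im * s) g x -
      scatterCoeff m b (Real.sign z.im * s) x * freeFlow m (Real.sign z.im * s) (fOdd g) x)
    ?_ (fun _ => perturbedGroup_ae hm b _ g)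
  refine (measurable_freeFlow m _ hg).sub (Measurable.mul ?_ (measurable_freeFlow m _ hgo))
  exact (measurable_scatterCoeff m b).comp
    ((measurable_fst.const_mul (Real.sign z.im)).prodMk measurable_snd)

/-! ### Integrals along trajectories and the trace of the free resolvent -/

theorem ae_ae_of_ae_swap {P : ℝ × ℝ → Prop} (h : ∀ᵐ x, P x) : ∀ᵐ p : ℝ, ∀ᵐ q : ℝ, P (q, p) :=
  Measure.ae_ae_of_ae_prod ((Measure.measurePreserving_swap (μ := (volume : Measure ℝ))
    (ν := (volume : Measure ℝ))).quasiMeasurePreserving.ae h)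

theorem ae_memLp_section (g : PhaseL2) : ∀ᵐ p : ℝ, MemLp (fun q => g (q, p)) 2 := by
  have h1 : Integrable (fun x => ‖g x‖ ^ 2) (volume.prod volume) :=
    (Lp.memLp g).integrable_norm_pow (by norm_num)
  filter_upwards [h1.prod_left_ae] with p hp
  refine (memLp_two_iff_integrable_sq_norm ?_).2 hp
  exact ((Lp.stronglyMeasurable g).measurable.comp
    (measurable_id.prodMk measurable_const)).aestronglyMeasurable

/-- Hölder: both factors are square integrable on the half-line. -/
theorem integrableOn_exp_mul_affine {G : ℝ → ℂ} (hG : MemLp G 2) (hGm : Measurable G) {w : ℂ}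
    (hw : w.re < 0) {c : ℝ} (hc : c ≠ 0) (q a : ℝ) :
    IntegrableOn (fun s : ℝ => Complex.exp (w * s) * G (q - c * s)) (Set.Ioi a) := by
  have h1 : MemLp (fun s : ℝ => G (q - c * s)) 2 := by
    have hm : Measurable fun s : ℝ => G (q - c * s) := by fun_prop
    refine (memLp_two_iff_integrable_sq_norm hm.aestronglyMeasurable).2 ?_
    exact (((memLp_two_iff_integrable_sq_norm hGm.aestronglyMeasurable).1 hG).comp_sub_left
      q).comp_mul_left' hc
  have h2 : MemLp (fun s : ℝ => Complex.exp (w * s)) 2 (volume.restrict (Set.Ioi a)) := by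
    refine (memLp_two_iff_integrable_sq_norm (by fun_prop)).2 ?_
    have h3 := (integrableOn_exp_mul_complex_Ioi (a := 2 * w) (by simpa using by linarith) a).norm
    refine h3.congr (ae_of_all _ fun s => ?_)
    simp only [← norm_pow, ← Complex.exp_nat_mul]
    push_cast
    ring_nf
  exact h2.integrable_mul (h1.restrict _)

theorem setIntegral_Ioi_comp_add (G : ℝ → ℂ) (a r : ℝ) :
    ∫ s in Set.Ioi a, G (s + r) = ∫ s in Set.Ioi (a + r), G s := by
  have h2 := (measurePreserving_add_right volume r).setIntegral_preimage_emb
    (measurableEmbedding_addRight r) G (Set.Ioi (a + r))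
  rwa [Set.preimage_add_const_Ioi, add_sub_cancel_right] at h2

/-- Integrals along a trajectory, with the time measured from the passage through `q = 0`. -/
theorem setIntegral_exp_mul_affine (G : ℝ → ℂ) (w : ℂ) {c : ℝ} (hc : c ≠ 0) (q a : ℝ) :
    ∫ s in Set.Ioi a, Complex.exp (w * s) * G (q - c * s) =
      Complex.exp (w * (q / c : ℝ)) *
        ∫ s in Set.Ioi (a - q / c), Complex.exp (w * s) * G (0 - c * s) := by
  rw [← integral_const_mul]
  have h := setIntegral_Ioi_comp_add (fun s : ℝ => Complex.exp (w * s) * G (q - c * s))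
    (a - q / c) (q / c)
  rw [sub_add_cancel] at h
  rw [← h]
  refine integral_congr_ae (ae_of_all _ fun s => ?_)
  simp only
  rw [← mul_assoc, ← Complex.exp_add]
  congr 2
  · push_cast; ring
  · field_simp
    ring

theorem continuous_setIntegral_Ioi {G : ℝ → ℂ} (hG : ∀ a, IntegrableOn G (Set.Ioi a)) :
    Continuous fun a => ∫ s in Set.Ioi a, G s := by
  have h1 : ∀ a b, IntervalIntegrable G volume a b := fun a b =>
    (intervalIntegrable_iff).2 ((hG (min a b)).mono_set fun x hx => hx.1)
  have h2 : (fun a => ∫ s in Set.Ioi a, G s) =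
      fun a => (∫ s in Set.Ioi (0 : ℝ), G s) - ∫ s in (0 : ℝ)..a, G s := by
    ext a
    rw [← intervalIntegral.integral_Ioi_sub_Ioi' (hG 0) (hG a), sub_sub_cancel]
  rw [h2]
  exact continuous_const.sub (intervalIntegral.continuous_primitive h1 0)

theorem freeFlow_sign_mul (m σ s : ℝ) (g : ℝ × ℝ → ℂ) (x : ℝ × ℝ) :
    freeFlow m (σ * s) g x = g (x.1 - σ * x.2 / m * s, x.2) := by
  rw [freeFlow]
  congr 2
  ring

theorem measurable_section {g : ℝ × ℝ → ℂ} (hg : Measurable g) (p : ℝ) :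
    Measurable fun q => g (q, p) := hg.comp (measurable_id.prodMk measurable_const)

/-- Once time is measured from the passage through q = 0, the variable q enters only through an
exponential factor and the lower limit of integration. -/
theorem continuous_freeRes {m : ℝ} (hm : 0 < m) {z : ℂ} (hz : z.im ≠ 0) {g : ℝ × ℝ → ℂ}
    (hg : Measurable g) {p : ℝ} (hp : p ≠ 0) (hgp : MemLp (fun q => g (q, p)) 2) :
    Continuous fun q => freeRes m z g (q, p) := by
  have hw := re_I_mul_sign_mul_neg hz
  have hc : Real.sign z.im * p / m ≠ 0 :=
    div_ne_zero (mul_ne_zero (by simpa [Real.sign_eq_zero_iff] using hz) hp) hm.ne'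
  simp only [freeRes, freeFlow_sign_mul]
  set c := Real.sign z.im * p / m
  set w := Complex.I * (Real.sign z.im : ℂ) * z
  have h0 : (fun q : ℝ => Complex.I * (Real.sign z.im : ℂ) *
      ∫ s in Set.Ioi (0 : ℝ), Complex.exp (w * s) * g (q - c * s, p)) =
      fun q : ℝ => Complex.I * (Real.sign z.im : ℂ) * (Complex.exp (w * (q / c : ℝ)) *
        ∫ s in Set.Ioi (0 - q / c), Complex.exp (w * s) * g (0 - c * s, p)) :=
    funext fun q => congrArg _ (setIntegral_exp_mul_affine (fun q => g (q, p)) w hc q 0)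
  rw [h0]
  have h1 := continuous_setIntegral_Ioi
    (integrableOn_exp_mul_affine hgp (measurable_section hg p) hw hc 0)
  have h2 : Continuous fun q : ℝ => 0 - q / c := by fun_prop
  have h3 := h1.comp h2
  simp only [Function.comp_def] at h3
  fun_prop

theorem isTrace_freeRes {m : ℝ} (hm : 0 < m) {z : ℂ} (hz : z.im ≠ 0) (g : PhaseL2) :
    IsTrace (laplaceResolvent (freeGroup m) z g : PhaseL2) fun p => freeRes m z g (0, p) := by
  refine ⟨freeRes m z g, laplaceResolvent_freeGroup_ae m hz g, ?_, ae_of_all _ fun p => rfl⟩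
  filter_upwards [ae_memLp_section g, Measure.ae_ne volume (0 : ℝ)] with p h1 h2
  exact continuous_freeRes hm hz (Lp.stronglyMeasurable g).measurable h2 h1

theorem IsTrace.unique {f : ℝ × ℝ → ℂ} {φ ψ : ℝ → ℂ} (hφ : IsTrace f φ) (hψ : IsTrace f ψ) :
    φ =ᵐ[volume] ψ := by
  obtain ⟨F, hF1, hF2, hF3⟩ := hφ
  obtain ⟨G, hG1, hG2, hG3⟩ := hψ
  filter_upwards [ae_ae_of_ae_swap (hF1.symm.trans hG1), hF2, hF3, hG2, hG3]
    with p h1 h2 h3 h4 h5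
  rw [h3, h5]
  exact congr_fun ((h2.ae_eq_iff_eq volume h4).1 h1) 0

theorem Gop_ae_congr (m : ℝ) (b : OnePoint ℝ) (z : ℂ) {φ ψ : ℝ → ℂ} (h : φ =ᵐ[volume] ψ) :
    Gop m z (Lam m b z (oddProj φ)) =ᵐ[volume] Gop m z (Lam m b z (oddProj ψ)) := by
  have h1 : ∀ᵐ p : ℝ, φ p = ψ p ∧ φ (-p) = ψ (-p) :=
    h.and ((Measure.measurePreserving_neg volume).quasiMeasurePreserving.ae h)
  have h2 : ∀ᵐ x : ℝ × ℝ, φ x.2 = ψ x.2 ∧ φ (-x.2) = ψ (-x.2) :=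
    Measure.quasiMeasurePreserving_snd.ae h1
  filter_upwards [h2] with x hx
  simp only [Gop, Lam, oddProj, hx.1, hx.2]

/-! ### The resolvent of the perturbed group -/

theorem heaviside_of_pos {a : ℝ} (h : 0 < a) : heaviside a = 1 := if_pos h

theorem heaviside_of_nonpos {a : ℝ} (h : a ≤ 0) : heaviside a = 0 := if_neg (not_lt.2 h)

theorem sign_mul_pos_iff (z : ℂ) {y : ℝ} : 0 < Real.sign z.im * y ↔ 0 < y * z.im := by
  rcases lt_trichotomy z.im 0 with h | h | h
  · rw [Real.sign_of_neg h, mul_comm y, neg_one_mul, neg_pos]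
    exact ⟨fun hy => mul_pos_of_neg_of_neg h hy, fun hy => (neg_iff_neg_of_mul_pos hy).1 h⟩
  · simp [h]
  · rw [Real.sign_of_pos h, one_mul, mul_pos_iff_of_pos_right h]

theorem gKer_mul_Lam {m : ℝ} (hm : 0 < m) (b : OnePoint ℝ) {z : ℂ} (hz : z.im ≠ 0)
    (φ : ℝ → ℂ) {x : ℝ × ℝ} (hp : x.2 ≠ 0) (hx : 0 < x.1 * x.2 * z.im) :
    Gop m z (Lam m b z (oddProj φ)) x =
      -(Complex.exp (Complex.I * m * z * x.1 / x.2) * (φ x.2 - φ (-x.2)) /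
        (1 + (Real.sign z.im : ℂ) * (Complex.I * kappa m b x.2))) := by
  have hσ : (Real.sign z.im : ℂ) ^ 2 = 1 := by
    rw [sq]
    exact_mod_cast sign_mul_sign_self hz
  have hmc : (m : ℂ) ≠ 0 := by exact_mod_cast hm.ne'
  have hpc : ((|x.2| : ℝ) : ℂ) ≠ 0 := by exact_mod_cast (abs_pos.2 hp).ne'
  have h1 : (1 : ℂ) + (Real.sign z.im : ℂ) * (Complex.I * kappa m b x.2) ≠ 0 := by
    intro h
    simpa using congrArg Complex.re h
  -- Factoring out -σim/(2|p|) uses σ² = 1 and i² = -1; this factor and the ½ of Π' then cancel the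
  -- prefactor of g_z.
  have h2 : (recip (Bfun b x.2) : ℂ) - (Real.sign z.im : ℂ) *
      (Complex.I * m / (2 * (|x.2| : ℝ))) =
      -((Real.sign z.im : ℂ) * (Complex.I * m / (2 * (|x.2| : ℝ)))) *
        (1 + (Real.sign z.im : ℂ) * (Complex.I * kappa m b x.2)) := by
    rw [kappa]
    push_cast
    field_simp
    linear_combination (2 * ((|x.2| : ℝ) : ℂ) * (recip (Bfun b x.2) : ℂ)) *
      ((Real.sign z.im : ℂ) ^ 2 * Complex.I_sq - hσ)
  have hs0 : (Real.sign z.im : ℂ) ≠ 0 := by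
    intro h
    simp [h] at hσ
  rw [Gop, gKer, heaviside_of_pos hx, Lam, oddProj, h2]
  field_simp
  simp

theorem scatterCoeff_of_nonpos (m : ℝ) (b : OnePoint ℝ) {z : ℂ} {x : ℝ × ℝ}
    (hx : x.1 * x.2 * z.im ≤ 0) {s : ℝ} (hs : 0 < s) :
    scatterCoeff m b (Real.sign z.im * s) x = 0 := by
  have h : Real.sign z.im * s * x.1 * x.2 ≤ 0 := by
    have h1 : ¬ 0 < Real.sign z.im * (x.1 * x.2) := by
      rw [sign_mul_pos_iff]
      exact not_lt.2 hx
    have h2 := mul_nonpos_of_nonneg_of_nonpos hs.le (not_lt.1 h1)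
    linarith
  rw [scatterCoeff, heaviside_of_nonpos h]
  simp

/-- As a function of s the coefficient is a step that switches on at the passage time q/c, with c =
σp/m: only for larger s does the backward trajectory cross q = 0. -/
theorem scatterCoeff_of_pos {m : ℝ} (hm : 0 < m) (b : OnePoint ℝ) {z : ℂ} {x : ℝ × ℝ}
    (hx : 0 < x.1 * x.2 * z.im) {s : ℝ} (hs : 0 < s) :
    scatterCoeff m b (Real.sign z.im * s) x =
      (Set.Ioi (x.1 / (Real.sign z.im * x.2 / m))).indicator
        (fun _ => 1 / (1 + (Real.sign z.im : ℂ) * (Complex.I * kappa m b x.2))) s := by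
  have hz : z.im ≠ 0 := by
    rintro h
    simp [h] at hx
  have hp : x.2 ≠ 0 := by
    rintro h
    simp [h] at hx
  have h1 : 0 < Real.sign z.im * (x.1 * x.2) := (sign_mul_pos_iff z).2 hx
  have h2 : 0 < Real.sign z.im * s * x.1 * x.2 := by
    have := mul_pos hs h1
    linarith
  have hσ := sign_mul_sign_self hz
  have hσa : |Real.sign z.im| = 1 := by
    rcases lt_or_gt_of_ne hz with h | h
    · simp [Real.sign_of_neg h]
    · simp [Real.sign_of_pos h]
  have hsign : Real.sign (Real.sign z.im * s) = Real.sign z.im := by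
    rcases lt_or_gt_of_ne hz with h | h
    · rw [Real.sign_of_neg h, Real.sign_of_neg (by linarith)]
    · rw [Real.sign_of_pos h, Real.sign_of_pos (by linarith)]
  have hs0 : Real.sign z.im ≠ 0 := by simpa [Real.sign_eq_zero_iff] using hz
  have hp1 : 0 < |x.2| := abs_pos.2 hp
  have e : x.1 / (Real.sign z.im * x.2 / m) = |x.1| * m / |x.2| := by
    have e1 : 0 < x.1 / (Real.sign z.im * x.2 / m) := by
      have : x.1 / (Real.sign z.im * x.2 / m) = Real.sign z.im * (x.1 * x.2) * m / x.2 ^ 2 := by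
        field_simp
        rw [sq, hσ, mul_one]
      rw [this]
      positivity
    rw [← abs_of_pos e1, abs_div, abs_div, abs_mul, hσa, one_mul, abs_of_pos hm]
    field_simp
  have e2 : 0 < |x.2 * (Real.sign z.im * s)| / m - |x.1| ↔ |x.1| * m / |x.2| < s := by
    rw [sub_pos, lt_div_iff₀ hm, div_lt_iff₀ hp1, abs_mul, abs_mul, hσa, one_mul, abs_of_pos hs,
      mul_comm s]
  rw [scatterCoeff_eq, hsign, e, heaviside_of_pos h2, one_mul]
  by_cases h : s ∈ Set.Ioi (|x.1| * m / |x.2|)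
  · rw [heaviside_of_pos (e2.2 h), Set.indicator_of_mem h, Complex.ofReal_one]
  · rw [heaviside_of_nonpos (not_lt.1 (mt e2.1 h)), Set.indicator_of_notMem h]
    simp

/-- If qp Im z ≤ 0, both correction terms vanish. Otherwise the scattered term is integrated over
(q/c, ∞) only, and shifting time by q/c turns it into e^{imzq/p} times the difference of the free
resolvents at (0, p) and (0, -p). -/
theorem perturbed_resolvent_apply {m : ℝ} (hm : 0 < m) (b : OnePoint ℝ) {z : ℂ} (hz : z.im ≠ 0)
    {g : ℝ × ℝ → ℂ} (hg : Measurable g) {x : ℝ × ℝ} (hp : x.2 ≠ 0)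
    (hg1 : MemLp (fun q => g (q, x.2)) 2) (hg2 : MemLp (fun q => g (q, -x.2)) 2) :
    Complex.I * (Real.sign z.im : ℂ) * ∫ s in Set.Ioi (0 : ℝ),
        Complex.exp (Complex.I * (Real.sign z.im : ℂ) * z * s) *
          (freeFlow m (Real.sign z.im * s) g x -
            scatterCoeff m b (Real.sign z.im * s) x * freeFlow m (Real.sign z.im * s) (fOdd g) x) =
      freeRes m z g x + Gop m z (Lam m b z (oddProj fun p => freeRes m z g (0, p))) x := by
  have hw := re_I_mul_sign_mul_neg hz
  rcases le_or_gt (x.1 * x.2 * z.im) 0 with hx | hx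
  · rw [Gop, gKer, heaviside_of_nonpos hx]
    simp only [Complex.ofReal_zero, zero_mul, add_zero, freeRes]
    congr 1
    refine setIntegral_congr_fun measurableSet_Ioi fun s hs => ?_
    simp only [scatterCoeff_of_nonpos m b hx hs, zero_mul, sub_zero]
  have hc : Real.sign z.im * x.2 / m ≠ 0 :=
    div_ne_zero (mul_ne_zero (by simpa [Real.sign_eq_zero_iff] using hz) hp) hm.ne'
  have hs0 : 0 ≤ x.1 / (Real.sign z.im * x.2 / m) := by
    have h1 : 0 < Real.sign z.im * (x.1 * x.2) := (sign_mul_pos_iff z).2 hx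
    have : x.1 / (Real.sign z.im * x.2 / m) =
        Real.sign z.im * (x.1 * x.2) * m / (Real.sign z.im * x.2) ^ 2 := by
      have := (div_ne_zero_iff.1 hc).1
      have := left_ne_zero_of_mul this
      field_simp
    rw [this]
    positivity
  have he : Complex.I * (Real.sign z.im : ℂ) * z * (x.1 / (Real.sign z.im * x.2 / m) : ℝ) =
      Complex.I * m * z * x.1 / x.2 := by
    have h1 : (Real.sign z.im : ℂ) ≠ 0 := by
      exact_mod_cast left_ne_zero_of_mul (div_ne_zero_iff.1 hc).1
    have h2 : (x.2 : ℂ) ≠ 0 := by exact_mod_cast hp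
    have h3 : (m : ℂ) ≠ 0 := by exact_mod_cast hm.ne'
    push_cast
    field_simp
  rw [gKer_mul_Lam hm b hz _ hp hx, ← he]
  have hS : ∀ s ∈ Set.Ioi (0 : ℝ), scatterCoeff m b (Real.sign z.im * s) x = _ :=
    fun s hs => scatterCoeff_of_pos hm b hx hs
  simp only [freeRes, freeFlow_sign_mul, fOdd]
  -- The reflected trajectory starts at -q with velocity -c, hence passes q = 0 at the same time.
  have hneg : Real.sign z.im * -x.2 / m = -(Real.sign z.im * x.2 / m) := by ring
  rw [hneg]
  generalize (1 : ℂ) + (Real.sign z.im : ℂ) * (Complex.I * kappa m b x.2) = D at *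
  set c := Real.sign z.im * x.2 / m
  set w := Complex.I * (Real.sign z.im : ℂ) * z
  set s₀ := x.1 / c
  have i1 := integrableOn_exp_mul_affine hg1 (measurable_section hg _) hw hc
  have i2 := integrableOn_exp_mul_affine hg2 (measurable_section hg _) hw (neg_ne_zero.2 hc)
  have key : ∫ s in Set.Ioi (0 : ℝ), Complex.exp (w * s) * (g (x.1 - c * s, x.2) -
        scatterCoeff m b (Real.sign z.im * s) x *
          (g (x.1 - c * s, x.2) - g (-(x.1 - c * s), -x.2))) =
      (∫ s in Set.Ioi (0 : ℝ), Complex.exp (w * s) * g (x.1 - c * s, x.2)) -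
        1 / D * ((∫ s in Set.Ioi s₀, Complex.exp (w * s) * g (x.1 - c * s, x.2)) -
          ∫ s in Set.Ioi s₀, Complex.exp (w * s) * g (-x.1 - -c * s, -x.2)) := by
    rw [← integral_sub (i1 _ _) (i2 _ _), ← integral_const_mul]
    have h1 : ∫ s in Set.Ioi s₀, 1 / D * (Complex.exp (w * s) * g (x.1 - c * s, x.2) -
          Complex.exp (w * s) * g (-x.1 - -c * s, -x.2)) =
        ∫ s in Set.Ioi (0 : ℝ), (Set.Ioi s₀).indicator (fun s : ℝ => 1 / D *
          (Complex.exp (w * s) * g (x.1 - c * s, x.2) -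
            Complex.exp (w * s) * g (-x.1 - -c * s, -x.2))) s := by
      rw [setIntegral_indicator measurableSet_Ioi, Set.Ioi_inter_Ioi, sup_of_le_right hs0]
    rw [h1, ← integral_sub (i1 _ _)]
    · refine setIntegral_congr_fun measurableSet_Ioi fun s hs => ?_
      rw [hS s hs, show -(x.1 - c * s) = -x.1 - -c * s by ring]
      by_cases h : s ∈ Set.Ioi s₀
      · rw [Set.indicator_of_mem h, Set.indicator_of_mem h]
        ring
      · rw [Set.indicator_of_notMem h, Set.indicator_of_notMem h]
        ring
    · refine Integrable.indicator (Integrable.const_mul ?_ _) measurableSet_Ioi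
      exact (i1 _ _).sub (i2 _ _)
  rw [key, setIntegral_exp_mul_affine (fun q => g (q, x.2)) w hc x.1 s₀,
    setIntegral_exp_mul_affine (fun q => g (q, -x.2)) w (neg_ne_zero.2 hc) (-x.1) s₀,
    neg_div_neg_eq, sub_self]
  ring

theorem laplaceResolvent_perturbedGroup_ae_eq {m : ℝ} (hm : 0 < m) (b : OnePoint ℝ) {z : ℂ}
    (hz : z.im ≠ 0) (g : PhaseL2) :
    (laplaceResolvent (perturbedGroup m b) z g : PhaseL2) =ᵐ[volume] fun x =>
      freeRes m z g x + Gop m z (Lam m b z (oddProj fun p => freeRes m z g (0, p))) x := by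
  have h1 := ae_memLp_section g
  have h2 : ∀ᵐ p : ℝ, p ≠ 0 ∧ MemLp (fun q => g (q, p)) 2 ∧ MemLp (fun q => g (q, -p)) 2 :=
    (Measure.ae_ne volume (0 : ℝ)).and
      (h1.and ((Measure.measurePreserving_neg volume).quasiMeasurePreserving.ae h1))
  filter_upwards [laplaceResolvent_perturbedGroup_ae hm b hz g,
    Measure.quasiMeasurePreserving_snd.ae h2] with x h3 h4
  rw [h3]
  exact perturbed_resolvent_apply hm b hz (Lp.stronglyMeasurable g).measurable h4.1 h4.2.1 h4.2.2

/-! ### Identification of the generators -/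

theorem mem_graph_L0_iff (m : ℝ) {z : ℂ} (hz : z.im ≠ 0) (f h : PhaseL2) :
    (f, h) ∈ (L0 m).graph ↔ f = laplaceResolvent (freeGroup m) z (h - z • f) := by
  rw [(isUnitaryGroup_freeGroup m).generator,
    tendsto_slope_iff_hasDerivAt (isUnitaryFlow_freeGroup m).map_zero,
    (isUnitaryFlow_freeGroup m).hasDerivAt_iff_eq_laplaceResolvent hz]

/-- The condition on h forces f_z to be the free resolvent of h - zf. Its trace is unique almost
everywhere, so the formula for f is the one already found for the perturbed resolvent. -/
theorem mem_graphLB_iff {m : ℝ} (hm : 0 < m) (b : OnePoint ℝ) {z : ℂ} (hz : z.im ≠ 0)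
    (f h : PhaseL2) :
    (f, h) ∈ graphLB m b z ↔ f = laplaceResolvent (perturbedGroup m b) z (h - z • f) := by
  constructor
  · rintro ⟨fz, φ, hφ, hf, hh⟩
    simp only at hf hh
    have h1 := (mem_graph_L0_iff m hz _ _).1 ((L0 m).mem_graph fz)
    rw [← hh] at h1
    have h2 := laplaceResolvent_freeGroup_ae m hz (h - z • f)
    have h3 := isTrace_freeRes hm hz (h - z • f)
    rw [← h1] at h2 h3
    refine Lp.ext ?_
    filter_upwards [hf, h2, Gop_ae_congr m b z (hφ.unique h3),
      laplaceResolvent_perturbedGroup_ae_eq hm b hz (h - z • f)] with x e1 e2 e3 e4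
    rw [e1, e2, e3, e4]
  · intro hf
    set g := h - z • f with hg
    set fz := laplaceResolvent (freeGroup m) z g with hfz
    -- The second component is L₀ f_z, since (L₀ - z) f_z = g.
    have h1 : (fz, g + z • fz) ∈ (L0 m).graph := by
      rw [mem_graph_L0_iff m hz, add_sub_cancel_right]
    obtain ⟨y, hy1, hy2⟩ := (LinearPMap.mem_graph_iff _).1 h1
    simp only at hy1 hy2
    refine ⟨y, fun p => freeRes m z g (0, p), ?_, ?_, ?_⟩
    · rw [hy1]
      exact isTrace_freeRes hm hz g
    · have h2 := laplaceResolvent_perturbedGroup_ae_eq hm b hz g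
      rw [← hf] at h2
      rw [hy1]
      filter_upwards [h2, laplaceResolvent_freeGroup_ae m hz g] with x e1 e2
      rw [e1, e2]
    · rw [hy2, hy1, add_sub_cancel_right]

theorem isUnitaryGroup_perturbedGroup {m : ℝ} (hm : 0 < m) (b : OnePoint ℝ) {z : ℂ}
    (hz : z.im ≠ 0) : IsUnitaryGroup (LB m b z) (perturbedGroup m b) := by
  have hU := isUnitaryFlow_perturbedGroup m b
  refine ⟨hU.map_zero, hU.map_add, hU.continuous, fun f h => ?_⟩
  rw [LB_graph hm.ne' b hz, tendsto_slope_iff_hasDerivAt hU.map_zero,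
    hU.hasDerivAt_iff_eq_laplaceResolvent hz, mem_graphLB_iff hm b hz]

/-- A unitary group is determined by its generator. -/
theorem IsUnitaryGroup.unique {A : PhaseL2 →ₗ.[ℂ] PhaseL2} {U V : ℝ → PhaseL2 ≃ₗᵢ[ℂ] PhaseL2}
    (hU : IsUnitaryGroup A U) (hV : IsUnitaryGroup A V) (t : ℝ) (f : PhaseL2) :
    U t f = V t f := by
  refine hU.isUnitaryFlow.unique hV.isUnitaryFlow (fun f g => ?_) t f
  -- Every possible derivative g has the form -ih, so the generator condition describes all
  -- differentiable orbits.
  have hI : g = -Complex.I • (Complex.I • g) := by simp [smul_smul]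
  rw [hI, ← tendsto_slope_iff_hasDerivAt hU.map_zero, ← tendsto_slope_iff_hasDerivAt hV.map_zero,
    ← hU.generator, ← hV.generator]

end

theorem proposition2p3 (m : ℝ) (hm : 0 < m) (b : OnePoint ℝ) (hb : b ≠ ((0 : ℝ) : OnePoint ℝ))
    (z : ℂ) (hz : z.im ≠ 0) :
    (∃ U₀, IsUnitaryGroup (L0 m) U₀) ∧
    (∃ U, IsUnitaryGroup (LB m b z) U) ∧
    ∀ U₀ U, IsUnitaryGroup (L0 m) U₀ → IsUnitaryGroup (LB m b z) U →
      ∀ (t : ℝ) (f : PhaseL2),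
        (U₀ t f =ᵐ[volume] freeFlow m t f) ∧
        (U t f =ᵐ[volume] fun x =>
          freeFlow m t f x -
            ((heaviside (t * x.1 * x.2) * heaviside (|x.2 * t| / m - |x.1|) : ℝ) : ℂ) /
              (1 + (Real.sign t : ℂ) *
                (2 * Complex.I * |x.2| / m * (recip (Bfun b x.2) : ℂ))) *
              freeFlow m t (fOdd f) x) := by
  have h₀ := isUnitaryGroup_freeGroup m
  have hB := isUnitaryGroup_perturbedGroup hm b hz
  refine ⟨⟨_, h₀⟩, ⟨_, hB⟩, fun U₀ U hU₀ hU t f => ⟨?_, ?_⟩⟩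
  · rw [hU₀.unique h₀]
    exact freeGroup_ae m t f
  · rw [hU.unique hB]
    exact perturbedGroup_ae hm b t f
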